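/- Let $\mathrm{Lin}_+$ be the set of linear maps (tensors) $F:\mathbb{R}^N\to\mathbb{R}^N$ with $\det F>0$ and $\mathrm{Orth}_+=SO(N)$ the rotation group. Let $\Omega\subset\mathbb{R}^N$ be a compact region that is the closure of its nonempty interior, and let $\partial\Omega=\mathcal{D}\cup\mathcal{L}$, where $\mathcal{D}$ and $\mathcal{L}$ are disjoint piecewise smooth hypersurfaces and $\mathcal{D}\neq\emptyset$; here piecewise smooth means that there is a closed set $Z\subset\partial\Omega$ (edges, corners, common border of $\mathcal{D}$ and $\mathcal{L}$) with $\mathcal{H}^{N-1}(Z)=0$ such that near each point of $\partial\Omega\setminus Z$ the set $\Omega$ is of the form $\{g\le 0\}$ with $g$ of class $C^1$, $\nabla g\ne 0$, and the boundary near that point lies entirely in $\mathcal{D}$ or entirely in $\mathcal{L}$. Let $n$ be the outward unit normal, defined at the smooth points of $\partial\Omega$. Let $W\in C^2(\mathrm{Lin}_+,\mathbb{R})$ and $S(F)=DW(F)$. A classical equilibrium is a map $y\in C^2(\mathrm{int}\,\Omega,\mathbb{R}^N)\cap C^1(\Omega,\mathbb{R}^N)$ (that is, $y$ is continuous on $\Omega$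 and $\nabla y$ extends continuously from $\mathrm{int}\,\Omega$ to $\Omega$) with $\nabla y\in\mathrm{Lin}_+$ on $\Omega$ and $\mathrm{div}\,S(\nabla y)=0$ in $\mathrm{int}\,\Omega$. For $F_0\in\mathrm{Lin}_+$, Problem A is to find a classical equilibrium $y$ with $y(x)=F_0x$ for all $x\in\mathcal{D}$ and $S(\nabla y)n=S(F_0)n$ at the smooth boundary points in $\mathcal{L}$. Suppose that $F_0=I$ and that (i) (Partition Condition) $x\cdot n(x)\ge 0$ at the smooth boundary points $x\in\mathcal{D}$, and $x\cdot n(x)\le 0$ at the smooth boundary points $x\in\mathcal{L}$; (ii) $W$ is rank-one convex: $W(A)-W(F)\ge S(F)\cdot(A-F)$ for all $A,F\in\mathrm{Lin}_+$ with $A-F=a\otimes b$, $a,b\in\mathbb{R}^N$; (iii) $W(F)>W(R)=W(I)$ for all $F\in\mathrm{Lin}_+\setminus\mathrm{Orth}_+$ and all $R\in\mathrm{Orth}_+$. Then $y(x)=x$ is a solution of Problem A, and it is the only one: every classical equilibrium solution $y$ of Problem A satisfies $y(x)=x$ for all $x\in\Omega$. -/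

import Mathlib

open Set Filter Topology MeasureTheory

namespace Elastostatics

/-- Euclidean `N`-space. -/
abbrev Pt (N : ℕ) := EuclideanSpace ℝ (Fin N)

/-- Second-order tensors: linear maps of Euclidean `N`-space. -/
abbrev Tensor (N : ℕ) := Pt N →L[ℝ] Pt N

/-- Tensors with positive determinant. -/
def LinPlus (N : ℕ) : Set (Tensor N) := {F | 0 < F.det}

/-- The rotation group `SO(N)`: tensors with `Rᵀ R = I` and `det R = 1`. -/
def OrthPlus (N : ℕ) : Set (Tensor N) := {R | R.adjoint ∘L R = 1 ∧ R.det = 1}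

/-- The tensor product `a ⊗ b`, that is `v ↦ (b · v) a`. -/
noncomputable def tensorProd {N : ℕ} (a b : Pt N) : Tensor N :=
  (innerSL ℝ b).smulRight a

/-- The Piola stress `S(F) = DW(F)`, as a tensor:
`S(F) = ∑ i j, (∂W/∂F i j) eᵢ ⊗ eⱼ`, where `∂W/∂F i j` is the derivative of `W` at `F`
in the direction `eᵢ ⊗ eⱼ`. -/
noncomputable def piola {N : ℕ} (W : Tensor N → ℝ) (F : Tensor N) : Tensor N :=
  ∑ i : Fin N, ∑ j : Fin N,
    fderiv ℝ W F (tensorProd (EuclideanSpace.single i 1) (EuclideanSpace.single j 1)) •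
      tensorProd (EuclideanSpace.single i 1) (EuclideanSpace.single j 1)

/-- The scalar product `A · B = tr (Aᵀ B)` of tensors. -/
noncomputable def tensorInner {N : ℕ} (A B : Tensor N) : ℝ :=
  LinearMap.trace ℝ (Pt N) ((A.adjoint ∘L B : Tensor N) : Pt N →ₗ[ℝ] Pt N)

/-- The divergence of a tensor field, `(div T)ᵢ = ∑ j, ∂ⱼ Tᵢⱼ`. -/
noncomputable def tensorDiv {N : ℕ} (T : Pt N → Tensor N) (x : Pt N) : Pt N :=
  ∑ j : Fin N, (fderiv ℝ T x (EuclideanSpace.single j 1)) (EuclideanSpace.single j 1)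

/-- Rank-one convexity of a (differentiable) stored energy `W` on `Lin₊`. -/
def RankOneConvex {N : ℕ} (W : Tensor N → ℝ) : Prop :=
  ∀ A ∈ LinPlus N, ∀ F ∈ LinPlus N, (∃ a b : Pt N, A - F = tensorProd a b) →
    tensorInner (piola W F) (A - F) ≤ W A - W F

/-- `n` is the outward unit normal of `Ω` at the boundary point `x`, and `x` is a smooth boundary
point: near `x` the set `Ω` is `{g ≤ 0}` for a `C¹` function `g` that vanishes at `x` and has
nonzero gradient there, and `n = ∇g(x) / |∇g(x)|`. -/
def IsOutwardUnitNormal {N : ℕ} (Ω : Set (Pt N)) (x n : Pt N) : Prop :=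
  ∃ (U : Set (Pt N)) (g : Pt N → ℝ), IsOpen U ∧ x ∈ U ∧ ContDiffOn ℝ 1 g U ∧
    (∀ z ∈ U, z ∈ Ω ↔ g z ≤ 0) ∧ g x = 0 ∧ gradient g x ≠ 0 ∧
    n = ‖gradient g x‖⁻¹ • gradient g x

/-- `Ω` is a compact region (the closure of its nonempty interior) whose boundary is the disjoint
union of the piecewise smooth hypersurfaces `D ≠ ∅` and `L`: outside a closed exceptional set `Z`
(edges, corners and the common border of `D` and `L`) of zero `(N-1)`-dimensional measure, every
boundary point is smooth and has a neighbourhood in the boundary that lies in `D` or in `L`. -/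
structure IsMixedRegion {N : ℕ} (Ω D L : Set (Pt N)) : Prop where
  isCompact : IsCompact Ω
  interior_nonempty : (interior Ω).Nonempty
  subset_closure_interior : Ω ⊆ closure (interior Ω)
  union_eq : D ∪ L = frontier Ω
  disjoint : Disjoint D L
  nonempty : D.Nonempty
  piecewise_smooth : ∃ Z : Set (Pt N), IsClosed Z ∧ Z ⊆ frontier Ω ∧
    Measure.hausdorffMeasure ((N : ℝ) - 1) Z = 0 ∧
    ∀ x ∈ frontier Ω \ Z, (∃ n, IsOutwardUnitNormal Ω x n) ∧
      ((∀ᶠ z in 𝓝[frontier Ω] x, z ∈ D) ∨ (∀ᶠ z in 𝓝[frontier Ω] x, z ∈ L))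

/-- The Partition Condition with respect to the origin. -/
def PartitionCondition {N : ℕ} (Ω D L : Set (Pt N)) : Prop :=
  (∀ x ∈ D, ∀ n, IsOutwardUnitNormal Ω x n → 0 ≤ inner ℝ x n) ∧
  (∀ x ∈ L, ∀ n, IsOutwardUnitNormal Ω x n → inner ℝ x n ≤ 0)

/-- The gradient `∇y` on the closed set `Ω`: the extension by limits of the derivative of `y`
from the interior of `Ω`. -/
noncomputable def grad {N : ℕ} (Ω : Set (Pt N)) (y : Pt N → Pt N) : Pt N → Tensor N :=
  extendFrom (interior Ω) (fderiv ℝ y)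

/-- In the interior, `grad` is the derivative of a `C¹` map. -/
theorem grad_eq_fderiv {N : ℕ} {Ω : Set (Pt N)} {y : Pt N → Pt N}
    (hy : ContDiffOn ℝ 1 y (interior Ω)) {x : Pt N} (hx : x ∈ interior Ω) :
    grad Ω y x = fderiv ℝ y x :=
  extendFrom_eq (subset_closure hx)
    ((hy.continuousOn_fderiv_of_isOpen isOpen_interior le_rfl) x hx)

/-- Classical equilibria: `y ∈ C²(int Ω) ∩ C¹(Ω)` (`y` and `∇y` extend continuously from the
interior to `Ω`) with `∇y ∈ Lin₊` on `Ω` and `div S(∇y) = 0` in the interior of `Ω`. Only the values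
of `y` on `Ω` matter. -/
structure IsClassicalEquilibrium {N : ℕ} (Ω : Set (Pt N)) (W : Tensor N → ℝ)
    (y : Pt N → Pt N) : Prop where
  contDiffOn_interior : ContDiffOn ℝ 2 y (interior Ω)
  continuousOn : ContinuousOn y Ω
  continuousOn_grad : ContinuousOn (grad Ω y) Ω
  grad_mem : ∀ x ∈ Ω, grad Ω y x ∈ LinPlus N
  div_eq_zero : ∀ x ∈ interior Ω, tensorDiv (fun z => piola W (grad Ω y z)) x = 0

/-- Solutions of the mixed displacement / dead-load traction problem with boundary data given by
the homogeneous deformation `x ↦ F₀ x`. -/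
structure IsProblemASolution {N : ℕ} (Ω D L : Set (Pt N)) (W : Tensor N → ℝ) (F₀ : Tensor N)
    (y : Pt N → Pt N) : Prop where
  equilibrium : IsClassicalEquilibrium Ω W y
  displacement : ∀ x ∈ D, y x = F₀ x
  traction : ∀ x ∈ L, ∀ n, IsOutwardUnitNormal Ω x n → piola W (grad Ω y x) n = piola W F₀ n

end Elastostatics

open Elastostatics

/-! Write `G` for `∇y`. The proof rests on Green's identity: the field `(W(G) - W(1)) x + S(G)ᵀ (y -
G x)` of an equilibrium has divergence `N (W(G) - W(1))` (`vdiv_greenField`), which is nonnegative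
because `1` minimises `W`. The boundary data make the same field point inwards
(`inner_greenField_nonpos`). On `L` the traction is `S(1) n = 0`, which leaves `(W(G) - W(1)) x · n
≤ 0`. On `D` the tangential derivatives of `y - x` vanish, so `G = 1 + a ⊗ n`, and the normal
component is `(x · n) (W(G) - W(1) - S(G) · (a ⊗ n))`, whose second factor is nonpositive by
rank-one convexity. A field with nonnegative divergence that nowhere points outwards is divergence
free (`IsRegularField.eq_zero`), so `W(G) = W(1)` and `G` is a rotation everywhere.

A `C²` map with rotation gradients has zero second derivative, so `G` is locally constant. At smooth
points of `D` it is a rank-one perturbation of `1` as well as a rotation, hence equal to `1`. The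
interior of `Ω` may be disconnected, so this value is carried inside by the divergence argument
again, with the field `φ(x) x` for locally constant `φ ≥ 0` (`eq_zero_of_fderiv_eq_zero`): once for
the distance from `G` to `1`, once for `‖y - x‖²`.

No surface measure is used. The boundary flux of `φ V` is encoded by the volume integral of `φ div V
+ V · ∇φ`. Its sign is found near each smooth boundary point by cutting off along level sets of a
defining function, then globally by a partition of unity; the exceptional set is removed by cutoffs
whose gradients have small `L¹` norm, since it is null in dimension `N - 1`. -/

namespace Elastostatics

/-! ### Divergence calculus and the divergence theorem with compact support. -/

/-- The divergence of a vector field. -/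
noncomputable def vdiv {N : ℕ} (V : Pt N → Pt N) (x : Pt N) : ℝ :=
  ∑ j : Fin N, (fderiv ℝ V x (EuclideanSpace.single j 1)) j

theorem sum_apply_smul_single {N : ℕ} (x : Pt N) :
    ∑ j : Fin N, x j • (EuclideanSpace.single j (1 : ℝ) : Pt N) = x := by
  ext i
  simp [Finset.sum_apply, Pi.single_apply]

theorem clm_apply_eq_sum {N : ℕ} {F : Type*} [NormedAddCommGroup F] [NormedSpace ℝ F]
    (L : Pt N →L[ℝ] F) (x : Pt N) :
    L x = ∑ j : Fin N, x j • L (EuclideanSpace.single j 1) := by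
  conv_lhs => rw [← sum_apply_smul_single x]
  simp

theorem vdiv_congr {N : ℕ} {V V' : Pt N → Pt N} {x : Pt N} (h : V =ᶠ[𝓝 x] V') :
    vdiv V x = vdiv V' x := by
  simp only [vdiv, h.fderiv_eq]

theorem vdiv_smul {N : ℕ} {ψ : Pt N → ℝ} {V : Pt N → Pt N} {x : Pt N}
    (hψ : DifferentiableAt ℝ ψ x) (hV : DifferentiableAt ℝ V x) :
    vdiv (fun z => ψ z • V z) x = ψ x * vdiv V x + fderiv ℝ ψ x (V x) := by
  have h : fderiv ℝ (fun z => ψ z • V z) x = _ := fderiv_fun_smul hψ hV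
  rw [clm_apply_eq_sum (fderiv ℝ ψ x) (V x)]
  simp only [vdiv, h, Finset.mul_sum, ← Finset.sum_add_distrib]
  refine Finset.sum_congr rfl fun j _ => ?_
  simp [mul_comm]

theorem vdiv_sub {N : ℕ} {V V' : Pt N → Pt N} {x : Pt N}
    (hV : DifferentiableAt ℝ V x) (hV' : DifferentiableAt ℝ V' x) :
    vdiv (fun z => V z - V' z) x = vdiv V x - vdiv V' x := by
  have h : fderiv ℝ (fun z => V z - V' z) x = _ := fderiv_fun_sub hV hV'
  simp [vdiv, h, ← Finset.sum_sub_distrib]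

theorem vdiv_add {N : ℕ} {V V' : Pt N → Pt N} {x : Pt N}
    (hV : DifferentiableAt ℝ V x) (hV' : DifferentiableAt ℝ V' x) :
    vdiv (fun z => V z + V' z) x = vdiv V x + vdiv V' x := by
  have h : fderiv ℝ (fun z => V z + V' z) x = _ := fderiv_fun_add hV hV'
  simp [vdiv, h, ← Finset.sum_add_distrib]

theorem vdiv_const {N : ℕ} (v x : Pt N) : vdiv (fun _ : Pt N => v) x = 0 := by
  simp [vdiv]

theorem vdiv_id {N : ℕ} (x : Pt N) : vdiv (fun z : Pt N => z) x = N := by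
  have : fderiv ℝ (fun z : Pt N => z) x = ContinuousLinearMap.id ℝ _ := fderiv_fun_id
  simp [vdiv, this]

/-- A `C¹` function on an open set, multiplied by a `C¹` cutoff supported there, is `C¹`. -/
theorem contDiff_smul_of_tsupport_subset {E F : Type*} [NormedAddCommGroup E] [NormedSpace ℝ E]
    [NormedAddCommGroup F] [NormedSpace ℝ F] {O : Set E} (hO : IsOpen O) {V : E → F}
    (hV : ContDiffOn ℝ 1 V O) {ψ : E → ℝ} (hψ : ContDiff ℝ 1 ψ) (hs : tsupport ψ ⊆ O) :
    ContDiff ℝ 1 (fun x => ψ x • V x) := by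
  rw [contDiff_iff_contDiffAt]
  intro x
  by_cases hx : x ∈ O
  · exact hψ.contDiffAt.smul (hV.contDiffAt (hO.mem_nhds hx))
  · have hx' : x ∉ tsupport ψ := fun h => hx (hs h)
    have : (fun x => ψ x • V x) =ᶠ[𝓝 x] fun _ => 0 := by
      filter_upwards [notMem_tsupport_iff_eventuallyEq.1 hx'] with z hz
      simp [hz]
    exact contDiffAt_const.congr_of_eventuallyEq this

theorem continuous_vdiv {N : ℕ} {V : Pt N → Pt N} (hV : ContDiff ℝ 1 V) :
    Continuous (vdiv V) := by
  unfold vdiv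
  have := hV.continuous_fderiv one_ne_zero
  fun_prop

theorem hasCompactSupport_vdiv {N : ℕ} {V : Pt N → Pt N} (hc : HasCompactSupport V) :
    HasCompactSupport (vdiv V) := by
  refine hc.mono' fun x hx => ?_
  by_contra h
  refine hx ?_
  rw [vdiv_congr (notMem_tsupport_iff_eventuallyEq.1 h)]
  exact vdiv_const 0 x

/-- The divergence theorem for compactly supported fields. -/
theorem integral_vdiv_eq_zero {N : ℕ} {V : Pt N → Pt N} (hV : ContDiff ℝ 1 V)
    (hc : HasCompactSupport V) : ∫ x, vdiv V x = 0 := by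
  have hcf : Continuous (fderiv ℝ V) := hV.continuous_fderiv one_ne_zero
  have hcs : HasCompactSupport (fderiv ℝ V) := hc.fderiv ℝ
  have hint : ∀ j : Fin N, Integrable
      (fun x => (fderiv ℝ V x (EuclideanSpace.single j 1)) j) := fun j => by
    refine Continuous.integrable_of_hasCompactSupport (by fun_prop) ?_
    refine hcs.mono fun x hx h => hx ?_
    simp [h]
  unfold vdiv
  rw [integral_finsetSum _ fun j _ => hint j]
  refine Finset.sum_eq_zero fun j _ => ?_
  have hd : Differentiable ℝ V := hV.differentiable one_ne_zero
  have hfd : ∀ x, fderiv ℝ (fun x => V x j) x (EuclideanSpace.single j 1)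
      = (fderiv ℝ V x (EuclideanSpace.single j 1)) j := fun x => by
    have := (EuclideanSpace.proj j : Pt N →L[ℝ] ℝ).hasFDerivAt.comp x (hd x).hasFDerivAt
    have h2 : HasFDerivAt (fun x => V x j) _ x := this
    rw [h2.fderiv]; rfl
  have hVj : Integrable (fun x => V x j) := by
    refine Continuous.integrable_of_hasCompactSupport (by have := hV.continuous; fun_prop) ?_
    refine hc.mono fun x hx h => hx ?_
    simp [h]
  -- Integration by parts against the constant `1` says that a directional derivative has integral
  -- zero.
  have key := integral_mul_fderiv_eq_neg_fderiv_mul_of_integrable (μ := (volume : Measure (Pt N)))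
    (f := fun _ => (1 : ℝ)) (g := fun x => V x j) (v := EuclideanSpace.single j 1)
    (by simp) (by simpa [hfd] using hint j) (by simpa using hVj)
    (fun x _ => differentiableAt_const _) (fun x _ => by
      have := hd x
      exact (EuclideanSpace.proj j : Pt N →L[ℝ] ℝ).differentiableAt.comp x this)
  simpa [hfd] using key

/-- Testing the divergence with a compactly supported `C¹` function. -/
theorem integral_mul_vdiv_add_eq_zero {N : ℕ} {O : Set (Pt N)} (hO : IsOpen O)
    {V : Pt N → Pt N} (hV : ContDiffOn ℝ 1 V O) {ψ : Pt N → ℝ} (hψ : ContDiff ℝ 1 ψ)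
    (hc : HasCompactSupport ψ) (hs : tsupport ψ ⊆ O) :
    IntegrableOn (fun x => ψ x * vdiv V x + fderiv ℝ ψ x (V x)) O ∧
      ∫ x in O, (ψ x * vdiv V x + fderiv ℝ ψ x (V x)) = 0 := by
  have hΦ := contDiff_smul_of_tsupport_subset hO hV hψ hs
  have hΦc : HasCompactSupport (fun x => ψ x • V x) := by
    refine hc.mono fun x hx h => hx ?_
    simp [h]
  have heq : (fun x => ψ x * vdiv V x + fderiv ℝ ψ x (V x)) = vdiv (fun x => ψ x • V x) := by
    ext x
    by_cases hx : x ∈ tsupport ψ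
    · exact (vdiv_smul (hψ.differentiable one_ne_zero x)
        ((hV.contDiffAt (hO.mem_nhds (hs hx))).differentiableAt one_ne_zero)).symm
    · have h0 := notMem_tsupport_iff_eventuallyEq.1 hx
      have h1 : (fun x => ψ x • V x) =ᶠ[𝓝 x] fun _ => 0 := by
        filter_upwards [h0] with z hz
        simp [hz]
      rw [vdiv_congr h1, vdiv_const, h0.fderiv_eq, h0.self_of_nhds]
      simp [Pi.zero_def]
  rw [heq]
  have hint := (continuous_vdiv hΦ).integrable_of_hasCompactSupport (hasCompactSupport_vdiv hΦc)
    (μ := volume)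
  refine ⟨hint.integrableOn, ?_⟩
  rw [setIntegral_eq_integral_of_forall_compl_eq_zero, integral_vdiv_eq_zero hΦ hΦc]
  intro x hx
  have h0 := notMem_tsupport_iff_eventuallyEq.1 (fun h => hx (hs h))
  have h1 : (fun x => ψ x • V x) =ᶠ[𝓝 x] fun _ => 0 := by
    filter_upwards [h0] with z hz
    simp [hz]
  rw [vdiv_congr h1, vdiv_const]

/-! ### Sign of the boundary flux away from the exceptional set. -/

/-- A one-sided divergence inequality near a level set: if `V` does not point towards larger values
of `g` in a collar of `{g = 0}`, then testing the divergence of `V` on `{g < 0}` with a nonnegative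
function gives a nonpositive number. -/
theorem setIntegral_le_zero_of_collar {N : ℕ} {O U : Set (Pt N)} (hO : IsOpen O) (hU : IsOpen U)
    {g : Pt N → ℝ} (hg : ContDiffOn ℝ 1 g U) (hOU : O = {x ∈ U | g x < 0})
    {V : Pt N → Pt N} (hV : ContDiffOn ℝ 1 V O) {φ : Pt N → ℝ} (hφ : ContDiff ℝ 1 φ)
    (hφ0 : ∀ x, 0 ≤ φ x) (hc : HasCompactSupport φ) (hs : tsupport φ ⊆ U) {η : ℝ} (hη : 0 < η)
    (hcollar : ∀ x ∈ O, x ∈ tsupport φ → -η < g x → fderiv ℝ g x (V x) ≤ 0)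
    (hint : IntegrableOn (fun x => φ x * vdiv V x + fderiv ℝ φ x (V x)) O) :
    ∫ x in O, (φ x * vdiv V x + fderiv ℝ φ x (V x)) ≤ 0 := by
  have hOsub : O ⊆ U := fun x hx => by rw [hOU] at hx; exact hx.1
  have hOneg : ∀ x ∈ O, g x < 0 := fun x hx => by rw [hOU] at hx; exact hx.2
  set G : Pt N → ℝ := fun x => φ x * vdiv V x + fderiv ℝ φ x (V x) with hG
  -- The cutoff `h n` rises from `0` to `1` in the layer `ε n ≤ -g ≤ 2 ε n`; the denominator `n + 3`
  -- keeps this layer inside the collar of width `η`.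
  set ε : ℕ → ℝ := fun n => η / (n + 3) with hε
  have hεpos : ∀ n, 0 < ε n := fun n => by positivity
  have h2ε : ∀ n, 2 * ε n < η := fun n => by
    have : (0 : ℝ) ≤ n := n.cast_nonneg
    have h3 : ε n * (n + 3) = η := by simp only [hε]; field_simp
    nlinarith [hεpos n]
  have hεlim : Tendsto ε atTop (𝓝 0) := by
    refine tendsto_const_nhds.div_atTop ?_
    exact tendsto_atTop_add_const_right _ _ tendsto_natCast_atTop_atTop
  set χ : ℝ → ℝ := fun t => Real.smoothTransition (t - 1) with hχ
  have hχd : ContDiff ℝ 1 χ := Real.smoothTransition.contDiff.comp (contDiff_id.sub contDiff_const)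
  have hχ0 : ∀ t, 0 ≤ χ t := fun t => Real.smoothTransition.nonneg _
  have hχ1 : ∀ t, χ t ≤ 1 := fun t => Real.smoothTransition.le_one _
  have hχmono : Monotone χ := fun s t hst => Real.smoothTransition.monotone (by linarith)
  have hχderiv : ∀ t, 2 < t → deriv χ t = 0 := fun t ht => by
    have : χ =ᶠ[𝓝 t] fun _ => 1 := by
      filter_upwards [lt_mem_nhds ht] with s hs
      exact Real.smoothTransition.one_of_one_le (by linarith)
    rw [this.deriv_eq]; simp
  set h : ℕ → Pt N → ℝ := fun n x => χ (-(g x) / ε n) with hh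
  have hhd : ∀ n, ContDiffOn ℝ 1 (h n) U := fun n =>
    hχd.comp_contDiffOn (hg.neg.div_const _)
  -- The divergence of `φ h V` has integral zero, and it exceeds `h G` by the term with `∇h`. That
  -- term is nonnegative: `h` decreases in `g`, and `V` does not increase `g` in the collar.
  have hstep : ∀ n, ∫ x in O, h n x * G x ≤ 0 := by
    intro n
    set ψ : Pt N → ℝ := fun x => φ x * h n x with hψ
    have hψd : ContDiff ℝ 1 ψ := by
      simpa only [smul_eq_mul] using contDiff_smul_of_tsupport_subset hU (hhd n) hφ hs
    set S : Set (Pt N) := {x ∈ tsupport φ | g x ≤ -ε n} with hS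
    have hSc : IsClosed S :=
      (hg.continuousOn.mono hs).preimage_isClosed_of_isClosed (isClosed_tsupport φ) isClosed_Iic
    have hψS : tsupport ψ ⊆ S := by
      refine closure_minimal (fun x hx => ?_) hSc
      have hx1 : φ x ≠ 0 := fun h0 => hx (by simp [hψ, h0])
      have hx2 : h n x ≠ 0 := fun h0 => hx (by simp [hψ, h0])
      refine ⟨subset_closure hx1, ?_⟩
      by_contra hlt
      push Not at hlt
      refine hx2 (Real.smoothTransition.zero_of_nonpos ?_)
      have : -(g x) / ε n ≤ 1 := by rw [div_le_one (hεpos n)]; linarith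
      linarith
    have hψO : tsupport ψ ⊆ O := fun x hx => by
      have := hψS hx
      rw [hOU]
      exact ⟨hs this.1, this.2.trans_lt (by linarith [hεpos n])⟩
    have hψc : HasCompactSupport ψ := by
      refine hc.mono fun x hx h0 => hx ?_
      simp [hψ, h0]
    obtain ⟨hi, h0⟩ := integral_mul_vdiv_add_eq_zero hO hV hψd hψc hψO
    rw [← h0]
    have hpt : ∀ x ∈ O, h n x * G x ≤ ψ x * vdiv V x + fderiv ℝ ψ x (V x) := by
      intro x hx
      have hxU := hU.mem_nhds (hOsub hx)
      have hgd : DifferentiableAt ℝ g x := (hg.contDiffAt hxU).differentiableAt one_ne_zero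
      have hhdx : HasFDerivAt (h n)
          (deriv χ (-(g x) / ε n) • ((ε n)⁻¹ • -(fderiv ℝ g x))) x := by
        have h1 : HasFDerivAt (fun z => -(g z) / ε n) ((ε n)⁻¹ • -(fderiv ℝ g x)) x := by
          have := (hgd.hasFDerivAt.neg).const_smul (ε n)⁻¹
          refine this.congr_of_eventuallyEq (Eventually.of_forall fun z => ?_)
          simp [div_eq_inv_mul]
        exact (hχd.differentiable one_ne_zero _).hasDerivAt.comp_hasFDerivAt x h1
      have hψx : fderiv ℝ ψ x = _ :=
        ((hφ.differentiable one_ne_zero x).hasFDerivAt.mul hhdx).fderiv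
      have hsign : 0 ≤ φ x * (deriv χ (-(g x) / ε n) * ((ε n)⁻¹ * -(fderiv ℝ g x (V x)))) := by
        by_cases hxs : x ∈ tsupport φ
        · by_cases hgη : -η < g x
          · have := hcollar x hx hxs hgη
            have hd0 : 0 ≤ deriv χ (-(g x) / ε n) := hχmono.deriv_nonneg
            have := hφ0 x
            have := inv_nonneg.2 (hεpos n).le
            refine mul_nonneg (hφ0 x) (mul_nonneg hd0 (mul_nonneg this (by linarith)))
          · rw [hχderiv _ (by rw [lt_div_iff₀ (hεpos n)]; linarith [h2ε n])]
            simp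
        · simp [image_eq_zero_of_notMem_tsupport hxs]
      rw [hψx]
      simp only [hG, hψ, add_apply, smul_apply,
        neg_apply, smul_eq_mul]
      linarith
    -- A non-integrable function has integral `0` by convention, so the bound holds in that case
    -- too.
    by_cases hGi : IntegrableOn (fun x => h n x * G x) O
    · exact setIntegral_mono_on hGi hi hO.measurableSet hpt
    · rw [integral_undef hGi, h0]
  have hlim : Tendsto (fun n => ∫ x in O, h n x * G x) atTop (𝓝 (∫ x in O, G x)) := by
    refine tendsto_integral_of_dominated_convergence (fun x => ‖G x‖) (fun n => ?_) hint.norm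
      (fun n => ?_) ?_
    · exact (((hhd n).continuousOn.mono hOsub).aestronglyMeasurable hO.measurableSet).mul
        hint.aestronglyMeasurable
    · refine Eventually.of_forall fun x => ?_
      rw [norm_mul, Real.norm_of_nonneg (hχ0 _)]
      exact mul_le_of_le_one_left (norm_nonneg _) (hχ1 _)
    · refine (ae_restrict_iff' hO.measurableSet).2 (Eventually.of_forall fun x hx => ?_)
      have hgx := hOneg x hx
      refine tendsto_const_nhds.congr' ?_
      have : ∀ᶠ n in atTop, ε n < -(g x) / 2 := hεlim.eventually_lt_const (by linarith)
      filter_upwards [this] with n hn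
      have : h n x = 1 := by
        refine Real.smoothTransition.one_of_one_le ?_
        have : 2 ≤ -(g x) / ε n := by rw [le_div_iff₀ (hεpos n)]; linarith
        linarith
      rw [this, one_mul]
  exact le_of_tendsto' hlim hstep

theorem fderiv_apply_eq_inner_gradient {N : ℕ} {g : Pt N → ℝ} {z : Pt N} (v : Pt N) :
    fderiv ℝ g z v = inner ℝ v (gradient g z) := by
  rw [real_inner_comm, ← toDual_gradient]
  rfl

/-- A local description of a closed region near a smooth boundary point, with a transversal
direction. -/
theorem IsOutwardUnitNormal.exists_chart {N : ℕ} {Ω : Set (Pt N)} (hΩ : IsClosed Ω) {p n : Pt N}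
    (h : IsOutwardUnitNormal Ω p n) :
    ∃ (U : Set (Pt N)) (g : Pt N → ℝ) (v : Pt N), IsOpen U ∧ p ∈ U ∧ ContDiffOn ℝ 1 g U ∧
      (∀ z ∈ U, 0 < fderiv ℝ g z v) ∧ (∀ z ∈ U, z ∈ Ω ↔ g z ≤ 0) ∧
      (∀ z ∈ U, z ∈ interior Ω ↔ g z < 0) ∧
      (∀ z ∈ U, z ∈ frontier Ω ↔ g z = 0) ∧
      (∀ z ∈ U, g z = 0 →
        IsOutwardUnitNormal Ω z (‖gradient g z‖⁻¹ • gradient g z)) ∧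
      g p = 0 ∧ n = ‖gradient g p‖⁻¹ • gradient g p := by
  obtain ⟨U₀, g, hU₀, hp, hg, hgΩ, hgp, hgrad, hn⟩ := h
  have hcf : ContinuousOn (fun z => fderiv ℝ g z (gradient g p)) U₀ :=
    (hg.continuousOn_fderiv_of_isOpen hU₀ le_rfl).clm_apply continuousOn_const
  -- Shrinking to where `g` increases along `∇g(p)` provides one transversal direction for the whole
  -- chart and keeps `∇g` nonzero there.
  have hUo : IsOpen (U₀ ∩ (fun z => fderiv ℝ g z (gradient g p)) ⁻¹' Ioi 0) :=
    hcf.isOpen_inter_preimage hU₀ isOpen_Ioi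
  -- An interior point with `g = 0` would be a local maximum of `g`, against the nonzero derivative.
  have hint : ∀ z ∈ U₀ ∩ (fun z => fderiv ℝ g z (gradient g p)) ⁻¹' Ioi 0,
      z ∈ interior Ω ↔ g z < 0 := by
    rintro z ⟨hz, hzv⟩
    constructor
    · intro hzi
      refine lt_of_le_of_ne ((hgΩ z hz).1 (interior_subset hzi)) fun h0 => ?_
      have hmax : IsLocalMax g z := by
        filter_upwards [isOpen_interior.mem_nhds hzi, hU₀.mem_nhds hz] with w hw hwU
        rw [h0]
        exact (hgΩ w hwU).1 (interior_subset hw)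
      have := hmax.fderiv_eq_zero
      simp [this] at hzv
    · intro hlt
      rw [mem_interior_iff_mem_nhds]
      filter_upwards [hU₀.mem_nhds hz,
        ((hg.continuousOn.continuousAt (hU₀.mem_nhds hz)).eventually_lt_const hlt)] with w hwU hw
      exact (hgΩ w hwU).2 hw.le
  refine ⟨_, g, gradient g p, hUo, ⟨hp, ?_⟩, hg.mono inter_subset_left, fun z hz => hz.2,
    fun z hz => hgΩ z hz.1, hint, fun z hz => ?_, fun z hz hz0 => ?_, hgp, hn⟩
  · simp only [mem_preimage, mem_Ioi, fderiv_apply_eq_inner_gradient, real_inner_self_eq_norm_sq]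
    have := norm_pos_iff.2 hgrad
    positivity
  · rw [hΩ.frontier_eq, Set.mem_sdiff, hgΩ z hz.1, hint z hz]
    constructor
    · rintro ⟨h1, h2⟩; linarith
    · intro h0; simp [h0]
  · refine ⟨U₀, g, hU₀, hz.1, hg, hgΩ, hz0, fun h0 => ?_, rfl⟩
    have h1 : 0 < fderiv ℝ g z (gradient g p) := hz.2
    rw [fderiv_apply_eq_inner_gradient, h0, inner_zero_right] at h1
    exact h1.false

/-- `V ∈ C(Ω) ∩ C¹(int Ω)` with divergence `f`, where `f` is continuous up to the boundary. -/
structure IsRegularField {N : ℕ} (Ω : Set (Pt N)) (V : Pt N → Pt N) (f : Pt N → ℝ) : Prop where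
  continuousOn : ContinuousOn V Ω
  contDiffOn : ContDiffOn ℝ 1 V (interior Ω)
  continuousOn_div : ContinuousOn f Ω
  vdiv_eq : ∀ x ∈ interior Ω, vdiv V x = f x

/-- The functional `φ ↦ ∫ (φ f + V · ∇φ)` over the interior of `Ω`. If `f` is the divergence of `V`
then it represents the flux of `φ V` through the boundary. -/
noncomputable def flux {N : ℕ} (Ω : Set (Pt N)) (V : Pt N → Pt N) (f : Pt N → ℝ)
    (φ : Pt N → ℝ) : ℝ :=
  ∫ x in interior Ω, (φ x * f x + fderiv ℝ φ x (V x))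

theorem IsRegularField.integrableOn {N : ℕ} {Ω : Set (Pt N)} (hΩ : IsCompact Ω) {V : Pt N → Pt N}
    {f : Pt N → ℝ} (h : IsRegularField Ω V f) {φ : Pt N → ℝ} (hφ : ContDiff ℝ 1 φ) :
    IntegrableOn (fun x => φ x * f x + fderiv ℝ φ x (V x)) (interior Ω) := by
  refine IntegrableOn.mono_set (ContinuousOn.integrableOn_compact hΩ ?_) interior_subset
  exact (hφ.continuous.continuousOn.mul h.continuousOn_div).add
    ((hφ.continuous_fderiv one_ne_zero).continuousOn.clm_apply h.continuousOn)

/-- The sign condition on `V` holds only on the boundary itself and may be an equality. Replacing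
`V` by `V - δ v`, with `v` transversal, makes it strict, so by compactness it persists in a collar;
then `δ → 0`. -/
theorem IsRegularField.flux_nonpos_of_normal {N : ℕ} {Ω : Set (Pt N)} (hΩ : IsCompact Ω)
    {V : Pt N → Pt N} {f : Pt N → ℝ} (h : IsRegularField Ω V f)
    {U : Set (Pt N)} (hU : IsOpen U) {g : Pt N → ℝ} (hg : ContDiffOn ℝ 1 g U) {v : Pt N}
    (hv : ∀ z ∈ U, 0 < fderiv ℝ g z v) (hgΩ : ∀ z ∈ U, z ∈ Ω ↔ g z ≤ 0)
    (hgint : ∀ z ∈ U, z ∈ interior Ω ↔ g z < 0)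
    (hVg : ∀ z ∈ U, g z = 0 → fderiv ℝ g z (V z) ≤ 0)
    {φ : Pt N → ℝ} (hφ : ContDiff ℝ 1 φ) (hφ0 : ∀ x, 0 ≤ φ x) (hc : HasCompactSupport φ)
    (hs : tsupport φ ⊆ U) : flux Ω V f φ ≤ 0 := by
  set O := interior Ω ∩ U with hO
  have hOo : IsOpen O := isOpen_interior.inter hU
  have hOeq : O = {x ∈ U | g x < 0} := by
    ext x
    simp only [hO, mem_inter_iff, mem_ofPred_eq]
    exact ⟨fun ⟨h1, h2⟩ => ⟨h2, (hgint x h2).1 h1⟩, fun ⟨h1, h2⟩ => ⟨(hgint x h1).2 h2, h1⟩⟩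
  have hint := h.integrableOn hΩ hφ
  have hintO := hint.mono_set (inter_subset_left : O ⊆ interior Ω)
  have hflux : flux Ω V f φ = ∫ x in O, (φ x * f x + fderiv ℝ φ x (V x)) := by
    refine setIntegral_eq_of_subset_of_forall_sdiff_eq_zero isOpen_interior.measurableSet
      inter_subset_left fun x hx => ?_
    have hx' : x ∉ tsupport φ := fun hxs => hx.2 ⟨hx.1, hs hxs⟩
    have h0 := notMem_tsupport_iff_eventuallyEq.1 hx'
    rw [h0.fderiv_eq, h0.self_of_nhds]
    simp [Pi.zero_def]
  have hφv : IntegrableOn (fun x => fderiv ℝ φ x v) O := by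
    have hcφ := (hφ.continuous_fderiv one_ne_zero).clm_apply (continuous_const (y := v))
    refine ((hcφ.continuousOn.integrableOn_compact hΩ).mono_set interior_subset).mono_set
      inter_subset_left
  have key : ∀ δ > 0, flux Ω V f φ ≤ δ * ∫ x in O, fderiv ℝ φ x v := by
    intro δ hδ
    set Vδ : Pt N → Pt N := fun x => V x - δ • v with hVδ
    have hVδd : ContDiffOn ℝ 1 Vδ O :=
      (h.contDiffOn.mono inter_subset_left).sub contDiffOn_const
    set K := tsupport φ ∩ Ω with hK
    have hKc : IsCompact K := IsCompact.inter hc hΩ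
    have hKU : K ⊆ U := fun x hx => hs hx.1
    have hcont : ContinuousOn (fun x => fderiv ℝ g x (Vδ x)) K :=
      ((hg.continuousOn_fderiv_of_isOpen hU le_rfl).mono hKU).clm_apply
        ((h.continuousOn.mono inter_subset_right).sub continuousOn_const)
    -- `B` collects the points where the perturbed field fails to point strictly inwards. It is
    -- compact and misses `{g = 0}`, so `g` stays below some `-η` on it.
    set B := K ∩ (fun x => fderiv ℝ g x (Vδ x)) ⁻¹' Ici 0 with hB
    have hBc : IsCompact B :=
      hKc.of_isClosed_subset (hcont.preimage_isClosed_of_isClosed hKc.isClosed isClosed_Ici)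
        inter_subset_left
    have hBneg : ∀ x ∈ B, g x < 0 := by
      rintro x ⟨hxK, hx⟩
      refine lt_of_le_of_ne ((hgΩ x (hKU hxK)).1 hxK.2) fun h0 => ?_
      have h1 := hVg x (hKU hxK) h0
      have h2 := hv x (hKU hxK)
      simp only [hVδ, mem_preimage, map_sub, map_smul, smul_eq_mul, mem_Ici] at hx
      nlinarith
    obtain ⟨η, hη, hηB⟩ : ∃ η > 0, ∀ x ∈ B, g x ≤ -η := by
      rcases B.eq_empty_or_nonempty with he | hne
      · exact ⟨1, one_pos, fun x hx => by simp [he] at hx⟩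
      · obtain ⟨x₀, hx₀, hmax⟩ := hBc.exists_isMaxOn hne
          (hg.continuousOn.mono (inter_subset_left.trans hKU))
        exact ⟨-g x₀, by linarith [hBneg x₀ hx₀], fun x hx => by simpa using hmax hx⟩
    have hpt : ∀ x ∈ O, φ x * vdiv Vδ x + fderiv ℝ φ x (Vδ x)
        = (φ x * f x + fderiv ℝ φ x (V x)) - δ * fderiv ℝ φ x v := by
      intro x hx
      have hVx := (h.contDiffOn.contDiffAt (isOpen_interior.mem_nhds hx.1)).differentiableAt
        one_ne_zero
      rw [hVδ, vdiv_sub hVx (differentiableAt_const _), vdiv_const, h.vdiv_eq x hx.1]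
      simp only [map_sub, map_smul, smul_eq_mul]
      ring
    have hi2 : IntegrableOn (fun x => φ x * vdiv Vδ x + fderiv ℝ φ x (Vδ x)) O :=
      (hintO.sub (hφv.const_mul δ)).congr_fun (fun x hx => (hpt x hx).symm) hOo.measurableSet
    have hle := setIntegral_le_zero_of_collar hOo hU hg hOeq hVδd hφ hφ0 hc hs hη
      (fun x hx hxs hgx => by
        by_contra hlt
        push Not at hlt
        have := hηB x ⟨⟨hxs, interior_subset hx.1⟩, hlt.le⟩
        linarith) hi2
    rw [setIntegral_congr_fun hOo.measurableSet hpt, integral_sub hintO (hφv.const_mul δ),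
      integral_const_mul, ← hflux] at hle
    linarith
  have hlim : Tendsto (fun δ : ℝ => δ * ∫ x in O, fderiv ℝ φ x v) (𝓝[>] 0) (𝓝 0) := by
    have : Tendsto (fun δ : ℝ => δ * ∫ x in O, fderiv ℝ φ x v) (𝓝 0)
        (𝓝 (0 * ∫ x in O, fderiv ℝ φ x v)) := tendsto_id.mul_const _
    rw [zero_mul] at this
    exact this.mono_left nhdsWithin_le_nhds
  refine ge_of_tendsto hlim ?_
  filter_upwards [self_mem_nhdsWithin] with δ hδ using key δ hδ

theorem IsRegularField.flux_eq_zero {N : ℕ} {Ω : Set (Pt N)}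
    {V : Pt N → Pt N} {f : Pt N → ℝ} (h : IsRegularField Ω V f)
    {φ : Pt N → ℝ} (hφ : ContDiff ℝ 1 φ) (hc : HasCompactSupport φ)
    (hs : tsupport φ ⊆ interior Ω) : flux Ω V f φ = 0 := by
  rw [← (integral_mul_vdiv_add_eq_zero isOpen_interior h.contDiffOn hφ hc hs).2]
  refine setIntegral_congr_fun isOpen_interior.measurableSet fun x hx => ?_
  simp only [h.vdiv_eq x hx]

/-- The flux of `φ V` is nonpositive if `V` does not point outwards at the smooth boundary points and
`φ ≥ 0` vanishes near the exceptional set `Z`. -/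
theorem IsRegularField.flux_nonpos {N : ℕ} {Ω Z : Set (Pt N)} (hΩ : IsCompact Ω)
    {V : Pt N → Pt N} {f : Pt N → ℝ} (h : IsRegularField Ω V f)
    (hsm : ∀ x ∈ frontier Ω \ Z, ∃ n, IsOutwardUnitNormal Ω x n) (hZ : IsClosed Z)
    (hV : ∀ x ∈ frontier Ω \ Z, ∀ n, IsOutwardUnitNormal Ω x n → inner ℝ (V x) n ≤ 0)
    {φ : Pt N → ℝ} (hφ : ContDiff ℝ 1 φ) (hφ0 : ∀ x, 0 ≤ φ x)
    (hs : Disjoint (tsupport φ) Z) : flux Ω V f φ ≤ 0 := by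
  have hloc : ∀ p ∈ Ω \ Z, ∃ U : Set (Pt N), IsOpen U ∧ p ∈ U ∧
      ∀ φ : Pt N → ℝ, ContDiff ℝ 1 φ → (∀ x, 0 ≤ φ x) → HasCompactSupport φ → tsupport φ ⊆ U →
        flux Ω V f φ ≤ 0 := by
    intro p hp
    by_cases hpi : p ∈ interior Ω
    · exact ⟨interior Ω, isOpen_interior, hpi, fun φ hφ _ hc hs => (h.flux_eq_zero hφ hc hs).le⟩
    · have hpf : p ∈ frontier Ω \ Z := ⟨by rw [hΩ.isClosed.frontier_eq]; exact ⟨hp.1, hpi⟩, hp.2⟩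
      obtain ⟨n, hn⟩ := hsm p hpf
      obtain ⟨U, g, v, hU, hpU, hg, hv, hgΩ, hgint, hgf, hnorm, -⟩ := hn.exists_chart hΩ.isClosed
      refine ⟨U ∩ Zᶜ, hU.inter hZ.isOpen_compl, ⟨hpU, hp.2⟩, fun φ hφ hφ0 hc hs => ?_⟩
      have hsub : U ∩ Zᶜ ⊆ U := inter_subset_left
      refine h.flux_nonpos_of_normal hΩ (hU.inter hZ.isOpen_compl) (hg.mono hsub)
        (fun z hz => hv z hz.1) (fun z hz => hgΩ z hz.1) (fun z hz => hgint z hz.1)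
        (fun z hz h0 => ?_) hφ hφ0 hc hs
      have h1 := hV z ⟨(hgf z hz.1).2 h0, hz.2⟩ _ (hnorm z hz.1 h0)
      rw [fderiv_apply_eq_inner_gradient]
      have hg0 : gradient g z ≠ 0 := fun h0 => by
        have h1 := hv z hz.1
        rw [fderiv_apply_eq_inner_gradient, h0, inner_zero_right] at h1
        exact h1.false
      rw [inner_smul_right] at h1
      exact nonpos_of_mul_nonpos_right h1 (inv_pos.2 (norm_pos_iff.2 hg0))
  set K := tsupport φ ∩ Ω with hK
  have hKc : IsCompact K := hΩ.inter_left (isClosed_tsupport φ)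
  have hKZ : ∀ p ∈ K, p ∈ Ω \ Z := fun p hp => ⟨hp.2, fun hz => hs.le_bot ⟨hp.1, hz⟩⟩
  choose! U hUo hpU hUflux using hloc
  -- Intersecting with unit balls gives the pieces of the partition compact support.
  obtain ⟨t, htK, htc⟩ := hKc.elim_nhds_subcover (fun p => U p ∩ Metric.ball p 1)
    (fun p hp => inter_mem ((hUo p (hKZ p hp)).mem_nhds (hpU p (hKZ p hp)))
      (Metric.ball_mem_nhds p one_pos))
  obtain ⟨F, hF⟩ := SmoothPartitionOfUnity.exists_isSubordinate (modelWithCornersSelf ℝ (Pt N))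
    hKc.isClosed (fun i : t => U i ∩ Metric.ball (i : Pt N) 1)
    (fun i => (hUo _ (hKZ _ (htK _ i.2))).inter Metric.isOpen_ball)
    (fun x hx => by
      have := htc hx
      simp only [mem_iUnion] at this ⊢
      obtain ⟨i, hi, hx⟩ := this
      exact ⟨⟨i, hi⟩, hx⟩)
  have hFd : ∀ i, ContDiff ℝ 1 (F i) := fun i =>
    ((contMDiff_iff_contDiff.1 (F i).contMDiff).of_le (by simp))
  have hprod : ∀ i, ContDiff ℝ 1 (fun x => φ x * F i x) := fun i => hφ.mul (hFd i)
  -- The pieces add up to `φ` only on `Ω`, which suffices because the flux integrates over the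
  -- interior.
  have hsum : ∀ x ∈ interior Ω, ∑ i : t, φ x * F i x = φ x := by
    intro x hx
    by_cases hxs : x ∈ tsupport φ
    · have := F.sum_eq_one (x := x) ⟨hxs, interior_subset hx⟩
      rw [finsum_eq_sum_of_fintype] at this
      rw [← Finset.mul_sum, this, mul_one]
    · simp [image_eq_zero_of_notMem_tsupport hxs]
  have heq : flux Ω V f φ = ∑ i : t, flux Ω V f (fun x => φ x * F i x) := by
    simp only [flux]
    rw [← integral_finsetSum _ fun i _ => h.integrableOn hΩ (hprod i)]
    refine setIntegral_congr_fun isOpen_interior.measurableSet fun x hx => ?_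
    have hev : φ =ᶠ[𝓝 x] fun z => ∑ i : t, φ z * F i z := by
      filter_upwards [isOpen_interior.mem_nhds hx] with z hz using (hsum z hz).symm
    have hd : fderiv ℝ φ x = ∑ i : t, fderiv ℝ (fun z => φ z * F i z) x := by
      rw [hev.fderiv_eq]
      exact fderiv_fun_sum fun i _ => (hprod i).differentiable one_ne_zero x
    simp only [Finset.sum_add_distrib, ← Finset.sum_mul, hsum x hx]
    rw [hd]
    simp
  rw [heq]
  refine Finset.sum_nonpos fun i _ => ?_
  have hts : tsupport (fun x => φ x * F i x) ⊆ tsupport (F i) := tsupport_mul_subset_right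
  refine hUflux i (hKZ _ (htK _ i.2)) _ (hprod i) (fun x => mul_nonneg (hφ0 x) (F.nonneg i x)) ?_
    (hts.trans ((hF i).trans inter_subset_left))
  refine HasCompactSupport.of_support_subset_isCompact (isCompact_closedBall (i : Pt N) 1) ?_
  exact (subset_tsupport _).trans (hts.trans ((hF i).trans
    (inter_subset_right.trans Metric.ball_subset_closedBall)))

/-! ### Removing an exceptional set of zero `(N - 1)`-dimensional measure. -/

/-- Cutoff functions that vanish on a ball of radius `r`, with a gradient of `L¹` norm
`O(r ^ (N - 1))`. -/
theorem exists_ball_cutoff (N : ℕ) : ∃ C : ℝ, 0 ≤ C ∧ ∀ (z : Pt N) (r : ℝ), 0 < r →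
    ∃ b : Pt N → ℝ, ContDiff ℝ 1 b ∧ (∀ x, 0 ≤ b x) ∧ (∀ x, b x ≤ 1) ∧
      (∀ x ∈ Metric.ball z r, b x = 0) ∧ (∀ x, 2 * r ≤ dist x z → b x = 1) ∧
      Integrable (fun x => ‖fderiv ℝ b x‖) ∧
      ∫ x, ‖fderiv ℝ b x‖ ≤ C * r ^ ((N : ℝ) - 1) := by
  -- `β` is `0` for `‖x‖ ≤ 1` and `1` for `‖x‖² ≥ 2`. Rescaling by `r` multiplies the gradient by
  -- `r⁻¹` and the volume by `r ^ N`, whence the power `N - 1`.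
  set β : Pt N → ℝ := fun x => Real.smoothTransition (‖x‖ ^ 2 - 1) with hβ
  have hβd : ContDiff ℝ 1 β :=
    Real.smoothTransition.contDiff.comp ((contDiff_norm_sq ℝ).sub contDiff_const)
  have hcf : Continuous (fderiv ℝ β) := hβd.continuous_fderiv one_ne_zero
  have hcs : HasCompactSupport (fderiv ℝ β) := by
    refine HasCompactSupport.of_support_subset_isCompact (isCompact_closedBall (0 : Pt N) 2) ?_
    intro x hx
    by_contra hlt
    refine hx ?_
    have h2 : 2 < ‖x‖ := by simpa using hlt
    have hev : β =ᶠ[𝓝 x] fun _ => 1 := by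
      filter_upwards [continuous_norm.continuousAt.eventually_const_lt h2] with y hy
      exact Real.smoothTransition.one_of_one_le (by nlinarith)
    rw [hev.fderiv_eq]
    simp
  have hF : Integrable (fun x => ‖fderiv ℝ β x‖) :=
    (hcf.integrable_of_hasCompactSupport hcs).norm
  refine ⟨∫ x, ‖fderiv ℝ β x‖, integral_nonneg fun _ => norm_nonneg _, fun z r hr => ?_⟩
  have hbd : ∀ x, HasFDerivAt (fun x => β (r⁻¹ • (x - z))) (r⁻¹ • fderiv ℝ β (r⁻¹ • (x - z))) x := by
    intro x
    have h1 : HasFDerivAt (fun x : Pt N => r⁻¹ • (x - z)) (r⁻¹ • ContinuousLinearMap.id ℝ (Pt N)) x :=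
      ((hasFDerivAt_id x).sub_const z).const_smul r⁻¹
    have := ((hβd.differentiable one_ne_zero (r⁻¹ • (x - z))).hasFDerivAt).comp x h1
    refine this.congr_fderiv ?_
    ext v
    simp
  have hnorm : (fun x => ‖fderiv ℝ (fun x => β (r⁻¹ • (x - z))) x‖)
      = fun x => r⁻¹ * ‖fderiv ℝ β (r⁻¹ • (x - z))‖ := by
    ext x
    rw [(hbd x).fderiv, norm_smul, Real.norm_of_nonneg (inv_pos.2 hr).le]
  have hint : Integrable (fun x => ‖fderiv ℝ β (r⁻¹ • (x - z))‖) :=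
    (hF.comp_smul (inv_ne_zero hr.ne')).comp_sub_right z
  refine ⟨fun x => β (r⁻¹ • (x - z)), hβd.comp (by fun_prop),
    fun x => Real.smoothTransition.nonneg _, fun x => Real.smoothTransition.le_one _,
    fun x hx => Real.smoothTransition.zero_of_nonpos ?_,
    fun x hx => Real.smoothTransition.one_of_one_le ?_, ?_, ?_⟩
  · have h1 : ‖r⁻¹ • (x - z)‖ ≤ 1 := by
      rw [norm_smul, Real.norm_of_nonneg (inv_pos.2 hr).le, ← dist_eq_norm, inv_mul_le_one₀ hr]
      exact (Metric.mem_ball.1 hx).le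
    nlinarith [norm_nonneg (r⁻¹ • (x - z))]
  · have h1 : 2 ≤ ‖r⁻¹ • (x - z)‖ := by
      rw [norm_smul, Real.norm_of_nonneg (inv_pos.2 hr).le, ← dist_eq_norm, le_inv_mul_iff₀ hr]
      linarith
    nlinarith
  · rw [hnorm]
    exact hint.const_mul _
  · rw [hnorm, integral_const_mul,
      integral_sub_right_eq_self (fun x => ‖fderiv ℝ β (r⁻¹ • x)‖) z,
      Measure.integral_comp_inv_smul_of_nonneg _ (fun x => ‖fderiv ℝ β x‖) hr.le]
    rw [finrank_euclideanSpace_fin, Real.rpow_sub_one hr.ne', Real.rpow_natCast, smul_eq_mul]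
    apply le_of_eq
    field_simp

/-- Products of the cutoff functions of `exists_ball_cutoff`. -/
theorem exists_finset_cutoff (N : ℕ) : ∃ C : ℝ, 0 ≤ C ∧ ∀ (s : Finset ℕ) (z : ℕ → Pt N)
    (r : ℕ → ℝ), (∀ i ∈ s, 0 < r i) →
    ∃ b : Pt N → ℝ, ContDiff ℝ 1 b ∧ (∀ x, 0 ≤ b x) ∧ (∀ x, b x ≤ 1) ∧
      (∀ i ∈ s, ∀ x ∈ Metric.ball (z i) (r i), b x = 0) ∧
      (∀ x, (∀ i ∈ s, 2 * r i ≤ dist x (z i)) → b x = 1) ∧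
      Integrable (fun x => ‖fderiv ℝ b x‖) ∧
      ∫ x, ‖fderiv ℝ b x‖ ≤ C * ∑ i ∈ s, r i ^ ((N : ℝ) - 1) := by
  obtain ⟨C, hC, hball⟩ := exists_ball_cutoff N
  refine ⟨C, hC, fun s z r hr => ?_⟩
  induction s using Finset.induction_on with
  | empty =>
    refine ⟨fun _ => 1, contDiff_const, by simp, by simp, by simp, by simp, by simp, by simp⟩
  | insert a s ha ih =>
    obtain ⟨b, hb, hb0, hb1, hbz, hbo, hbi, hbI⟩ := ih fun i hi => hr i (Finset.mem_insert_of_mem hi)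
    obtain ⟨c, hc, hc0, hc1, hcz, hco, hci, hcI⟩ :=
      hball (z a) (r a) (hr a (Finset.mem_insert_self _ _))
    -- Both factors lie in `[0, 1]`, so the gradient norms simply add and `C` does not depend on the
    -- number of balls.
    have hle : ∀ x, ‖fderiv ℝ (fun x => c x * b x) x‖ ≤ ‖fderiv ℝ c x‖ + ‖fderiv ℝ b x‖ := by
      intro x
      have h1 : fderiv ℝ (fun x => c x * b x) x = c x • fderiv ℝ b x + b x • fderiv ℝ c x :=
        fderiv_fun_mul (hc.differentiable one_ne_zero x) (hb.differentiable one_ne_zero x)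
      rw [h1]
      refine (norm_add_le _ _).trans ?_
      rw [norm_smul, norm_smul, Real.norm_of_nonneg (hc0 x), Real.norm_of_nonneg (hb0 x), add_comm]
      exact add_le_add (mul_le_of_le_one_left (norm_nonneg _) (hb1 x))
        (mul_le_of_le_one_left (norm_nonneg _) (hc1 x))
    have hcont : Continuous (fderiv ℝ (fun x => c x * b x)) :=
      (hc.mul hb).continuous_fderiv one_ne_zero
    have hI : Integrable (fun x => ‖fderiv ℝ (fun x => c x * b x) x‖) :=
      (hci.add hbi).mono' hcont.norm.aestronglyMeasurable
        (Eventually.of_forall fun x => by simpa using hle x)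
    refine ⟨fun x => c x * b x, hc.mul hb, fun x => mul_nonneg (hc0 x) (hb0 x),
      fun x => mul_le_one₀ (hc1 x) (hb0 x) (hb1 x), ?_, ?_, hI, ?_⟩
    · intro i hi x hx
      rcases Finset.mem_insert.1 hi with rfl | hi
      · simp [hcz x hx]
      · simp [hbz i hi x hx]
    · intro x hx
      simp [hco x (hx a (Finset.mem_insert_self _ _)),
        hbo x fun i hi => hx i (Finset.mem_insert_of_mem hi)]
    · rw [Finset.sum_insert ha, mul_add]
      refine (integral_mono hI (hci.add hbi) hle).trans ?_
      simp only [Pi.add_apply]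
      rw [integral_add hci hbi]
      exact add_le_add hcI hbI

/-- Compact sets of zero `d`-dimensional measure have finite covers by balls with arbitrarily small
`∑ rᵢ ^ d`. -/
theorem exists_finset_ball_cover {X : Type*} [MetricSpace X] [MeasurableSpace X] [BorelSpace X]
    {Z : Set X} (hZ : IsCompact Z) {d : ℝ} (hd : 0 ≤ d)
    (h0 : Measure.hausdorffMeasure d Z = 0) {ε ρ : ℝ} (hε : 0 < ε) (hρ : 0 < ρ) [Nonempty X] :
    ∃ (s : Finset ℕ) (z : ℕ → X) (r : ℕ → ℝ), (∀ i ∈ s, z i ∈ Z) ∧ (∀ i ∈ s, 0 < r i) ∧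
      (∀ i ∈ s, r i ≤ ρ) ∧ Z ⊆ ⋃ i ∈ s, Metric.ball (z i) (r i) ∧ ∑ i ∈ s, r i ^ d ≤ ε := by
  rw [Measure.hausdorffMeasure_apply] at h0
  have h1 := (ENNReal.iSup_eq_zero.1 (ENNReal.iSup_eq_zero.1 h0 (ENNReal.ofReal (ρ / 2))))
    (ENNReal.ofReal_pos.2 (half_pos hρ))
  have h2 : (0 : ENNReal) < ENNReal.ofReal (ε / 2) := ENNReal.ofReal_pos.2 (half_pos hε)
  rw [← h1] at h2
  simp only [iInf_lt_iff] at h2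
  obtain ⟨t, htZ, htd, hsum⟩ := h2
  have hfin : ∀ n, Metric.ediam (t n) ≠ ⊤ := fun n => ((htd n).trans_lt ENNReal.ofReal_lt_top).ne
  set D : ℕ → ℝ := fun n => (Metric.ediam (t n)).toReal with hD
  have hD0 : ∀ n, 0 ≤ D n := fun n => ENNReal.toReal_nonneg
  have hDρ : ∀ n, D n < ρ := fun n => by
    have := ENNReal.toReal_mono ENNReal.ofReal_ne_top (htd n)
    rw [ENNReal.toReal_ofReal (half_pos hρ).le] at this
    simp only [hD]
    linarith
  -- A radius strictly above the diameter lets an open ball about any point of `t n` cover `t n`;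
  -- the excesses sum to at most `ε / 2`.
  have hr : ∀ n, ∃ r, D n < r ∧ r ≤ ρ ∧ r ^ d ≤ D n ^ d + ε / 4 * (1 / 2) ^ n := by
    intro n
    have hc : ContinuousAt (fun x : ℝ => x ^ d) (D n) := (Real.continuous_rpow_const hd).continuousAt
    have hlt : D n ^ d < D n ^ d + ε / 4 * (1 / 2) ^ n := by
      have : 0 < ε / 4 * (1 / 2) ^ n := by positivity
      linarith
    have hev : ∀ᶠ r in 𝓝[>] (D n), r ^ d < D n ^ d + ε / 4 * (1 / 2) ^ n :=
      (hc.eventually_lt_const hlt).filter_mono nhdsWithin_le_nhds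
    have hev2 : ∀ᶠ r in 𝓝[>] (D n), r < ρ :=
      nhdsWithin_le_nhds (Iio_mem_nhds (hDρ n))
    obtain ⟨r, h1, h2, h3⟩ := (hev.and (hev2.and self_mem_nhdsWithin)).exists
    exact ⟨r, h3, h2.le, h1.le⟩
  choose r hDr hrρ hrd using hr
  -- Only the pieces that meet `Z` are kept, so that all centres can be taken in `Z`.
  set A : Set ℕ := {n | (t n ∩ Z).Nonempty} with hA
  have hz : ∀ n, ∃ z, n ∈ A → z ∈ t n ∩ Z := fun n => by
    by_cases hn : n ∈ A
    · obtain ⟨z, hz⟩ := hn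
      exact ⟨z, fun _ => hz⟩
    · exact ⟨Classical.arbitrary X, fun h => absurd h hn⟩
  choose z hz using hz
  have hcov : Z ⊆ ⋃ n ∈ A, Metric.ball (z n) (r n) := by
    intro x hx
    obtain ⟨n, hn⟩ := mem_iUnion.1 (htZ hx)
    have hnA : n ∈ A := ⟨x, hn, hx⟩
    refine mem_iUnion₂.2 ⟨n, hnA, ?_⟩
    rw [Metric.mem_ball]
    refine lt_of_le_of_lt ?_ (hDr n)
    rw [dist_edist]
    exact ENNReal.toReal_mono (hfin n) (Metric.edist_le_ediam_of_mem hn (hz n hnA).1)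
  obtain ⟨b, hbA, hbf, hbc⟩ := hZ.elim_finite_subcover_image (fun n _ => Metric.isOpen_ball) hcov
  refine ⟨hbf.toFinset, z, r, fun i hi => (hz i (hbA (hbf.mem_toFinset.1 hi))).2,
    fun i _ => (hD0 i).trans_lt (hDr i), fun i _ => hrρ i, by simpa using hbc, ?_⟩
  have hle : ∑ i ∈ hbf.toFinset, D i ^ d ≤ ε / 2 := by
    rw [← ENNReal.ofReal_le_ofReal_iff (half_pos hε).le,
      ENNReal.ofReal_sum_of_nonneg fun i _ => Real.rpow_nonneg (hD0 i) d]
    refine le_trans ?_ hsum.le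
    refine le_trans ?_ (ENNReal.sum_le_tsum hbf.toFinset)
    refine Finset.sum_le_sum fun i hi => ?_
    obtain ⟨w, hw⟩ := hbA (hbf.mem_toFinset.1 hi)
    -- The Hausdorff sum counts nonempty pieces only, which matters for `d = 0`.
    refine le_trans ?_ (le_iSup _ (⟨w, hw.1⟩ : (t i).Nonempty))
    rw [← ENNReal.ofReal_rpow_of_nonneg (hD0 i) hd, ENNReal.ofReal_toReal (hfin i)]
  have hgeo : ∑ i ∈ hbf.toFinset, ε / 4 * (1 / 2 : ℝ) ^ i ≤ ε / 2 := by
    rw [← Finset.mul_sum]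
    have := summable_geometric_two.sum_le_tsum hbf.toFinset fun i _ => by positivity
    rw [tsum_geometric_two] at this
    nlinarith
  calc ∑ i ∈ hbf.toFinset, r i ^ d ≤ ∑ i ∈ hbf.toFinset, (D i ^ d + ε / 4 * (1 / 2 : ℝ) ^ i) :=
        Finset.sum_le_sum fun i _ => hrd i
    _ ≤ ε := by rw [Finset.sum_add_distrib]; linarith

/-- A field with nonnegative divergence that does not point outwards at the smooth boundary points
is divergence free. -/
theorem IsRegularField.eq_zero {N : ℕ} (hN : 1 ≤ N) {Ω Z : Set (Pt N)} (hΩ : IsCompact Ω)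
    {V : Pt N → Pt N} {f : Pt N → ℝ} (h : IsRegularField Ω V f)
    (hsm : ∀ x ∈ frontier Ω \ Z, ∃ n, IsOutwardUnitNormal Ω x n) (hZ : IsClosed Z)
    (hZf : Z ⊆ frontier Ω) (hZ0 : Measure.hausdorffMeasure ((N : ℝ) - 1) Z = 0)
    (hV : ∀ x ∈ frontier Ω \ Z, ∀ n, IsOutwardUnitNormal Ω x n → inner ℝ (V x) n ≤ 0)
    (hf : ∀ x ∈ interior Ω, 0 ≤ f x) : ∀ x ∈ interior Ω, f x = 0 := by
  by_contra hcon
  push Not at hcon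
  obtain ⟨x₀, hx₀, hne⟩ := hcon
  have hpos : 0 < f x₀ := lt_of_le_of_ne (hf x₀ hx₀) hne.symm
  have hZc : IsCompact Z := hΩ.of_isClosed_subset hZ
    (hZf.trans (hΩ.isClosed.frontier_subset))
  have hfc : ContinuousAt f x₀ :=
    (h.continuousOn_div.mono interior_subset).continuousAt (isOpen_interior.mem_nhds hx₀)
  obtain ⟨R, hR, hRsub⟩ := Metric.mem_nhds_iff.1 (inter_mem (isOpen_interior.mem_nhds hx₀)
    (hfc.eventually_const_lt (half_lt_self hpos)))
  -- The centres lie in `Z`, at distance at least `R` from `x₀`, and the radii are at most `ρ`.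
  -- Points of the `ρ`-ball about `x₀` are thus at least `2 ρ` from every centre, where the cutoff
  -- is `1`.
  set ρ := R / 3 with hρ
  have hρ0 : 0 < ρ := by positivity
  have hballsub : Metric.ball x₀ ρ ⊆ Metric.ball x₀ R :=
    Metric.ball_subset_ball (by rw [hρ]; linarith)
  have hballint : Metric.ball x₀ ρ ⊆ interior Ω := fun x hx => (hRsub (hballsub hx)).1
  obtain ⟨M, hM⟩ := hΩ.exists_bound_of_continuousOn h.continuousOn
  have hM0 : 0 ≤ M := (norm_nonneg _).trans (hM x₀ (interior_subset hx₀))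
  obtain ⟨C, hC, hcut⟩ := exists_finset_cutoff N
  set κ := volume.real (Metric.ball x₀ ρ) * (f x₀ / 2) with hκ
  have hκ0 : 0 < κ := mul_pos (ENNReal.toReal_pos (Metric.measure_ball_pos _ _ hρ0).ne'
    measure_ball_lt_top.ne) (half_pos hpos)
  have hd : (0 : ℝ) ≤ (N : ℝ) - 1 := by
    have : (1 : ℝ) ≤ N := by exact_mod_cast hN
    linarith
  -- This bounds the gradient term by `M C ε < κ`; the `+ 1` covers `M C = 0`.
  have hε : 0 < κ / (2 * (M * C + 1)) := by positivity
  obtain ⟨s, z, r, hzZ, hr0, hrρ, hcov, hsum⟩ := exists_finset_ball_cover hZc hd hZ0 hε hρ0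
  obtain ⟨b, hb, hb0, hb1, hbz, hbo, hbi, hbI⟩ := hcut s z r hr0
  have hdisj : Disjoint (tsupport b) Z := by
    rw [disjoint_left]
    intro x hx hxZ
    obtain ⟨i, hi, hxi⟩ := mem_iUnion₂.1 (hcov hxZ)
    refine notMem_tsupport_iff_eventuallyEq.2 ?_ hx
    filter_upwards [Metric.isOpen_ball.mem_nhds hxi] with y hy using hbz i hi y hy
  -- The flux inequality bounds the integral of `b f` by that of `|V · ∇b|`, which is below `κ`,
  -- whereas the ball about `x₀` alone contributes at least `κ`.
  have hflux := h.flux_nonpos hΩ hsm hZ hV hb hb0 hdisj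
  have hi1 : IntegrableOn (fun x => b x * f x) (interior Ω) :=
    ((hb.continuous.continuousOn.mul h.continuousOn_div).integrableOn_compact hΩ).mono_set
      interior_subset
  have hi2 : IntegrableOn (fun x => fderiv ℝ b x (V x)) (interior Ω) :=
    ((((hb.continuous_fderiv one_ne_zero).continuousOn.clm_apply
      h.continuousOn)).integrableOn_compact hΩ).mono_set interior_subset
  rw [flux, integral_add hi1 hi2] at hflux
  have hlow : κ ≤ ∫ x in interior Ω, b x * f x := by
    calc κ = ∫ x in Metric.ball x₀ ρ, f x₀ / 2 := by simp [hκ]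
      _ ≤ ∫ x in Metric.ball x₀ ρ, b x * f x := by
        refine setIntegral_mono_on (integrableOn_const measure_ball_lt_top.ne)
          (hi1.mono_set hballint) measurableSet_ball fun x hx => ?_
        have hb1 : b x = 1 := by
          refine hbo x fun i hi => ?_
          have h1 : R ≤ dist (z i) x₀ := by
            by_contra hlt
            push Not at hlt
            have := (hRsub (Metric.mem_ball.2 hlt)).1
            exact (hZf (hzZ i hi)).2 this
          have h2 := hrρ i hi
          have h3 := Metric.mem_ball.1 hx
          have h4 := dist_triangle_left (z i) x₀ x
          rw [hρ] at h2 h3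
          linarith
        rw [hb1, one_mul]
        exact (hRsub (hballsub hx)).2.le
      _ ≤ ∫ x in interior Ω, b x * f x :=
        setIntegral_mono_set hi1 ((ae_restrict_iff' isOpen_interior.measurableSet).2
          (Eventually.of_forall fun x hx => mul_nonneg (hb0 x) (hf x hx)))
          (Eventually.of_forall hballint)
  have hup : |∫ x in interior Ω, fderiv ℝ b x (V x)| ≤ M * (C * (κ / (2 * (M * C + 1)))) := by
    calc |∫ x in interior Ω, fderiv ℝ b x (V x)|
        ≤ ∫ x in interior Ω, ‖fderiv ℝ b x (V x)‖ := by
          rw [← Real.norm_eq_abs]; exact norm_integral_le_integral_norm _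
      _ ≤ ∫ x in interior Ω, M * ‖fderiv ℝ b x‖ := by
          refine setIntegral_mono_on hi2.norm (hbi.const_mul M).integrableOn
            isOpen_interior.measurableSet fun x hx => ?_
          rw [mul_comm]
          exact (ContinuousLinearMap.le_opNorm _ _).trans
            (mul_le_mul_of_nonneg_left (hM x (interior_subset hx)) (norm_nonneg _))
      _ ≤ ∫ x, M * ‖fderiv ℝ b x‖ := setIntegral_le_integral (hbi.const_mul M)
          (Eventually.of_forall fun x => mul_nonneg hM0 (norm_nonneg _))
      _ ≤ M * (C * (κ / (2 * (M * C + 1)))) := by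
          rw [integral_const_mul]
          exact mul_le_mul_of_nonneg_left (hbI.trans (mul_le_mul_of_nonneg_left hsum hC)) hM0
  have h5 : M * (C * (κ / (2 * (M * C + 1)))) < κ := by
    have hMC : 0 ≤ M * C := mul_nonneg hM0 hC
    rw [← mul_assoc, mul_div_assoc', div_lt_iff₀ (by positivity)]
    nlinarith
  have := abs_le.1 hup
  linarith

/-! ### Tensor algebra. -/

theorem isOpen_linPlus (N : ℕ) : IsOpen (LinPlus N) :=
  isOpen_lt continuous_const ContinuousLinearMap.continuous_det

theorem one_mem_linPlus (N : ℕ) : (1 : Tensor N) ∈ LinPlus N := by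
  have : (1 : Tensor N).det = 1 := by
    rw [ContinuousLinearMap.det]
    exact LinearMap.det_id
  simp [LinPlus, this]

@[simp]
theorem tensorProd_apply {N : ℕ} (a b v : Pt N) : tensorProd a b v = inner ℝ b v • a := by
  simp [tensorProd]

theorem tensorProd_eq_sum {N : ℕ} (a b : Pt N) :
    tensorProd a b = ∑ i : Fin N, ∑ j : Fin N, (a i * b j) •
      tensorProd (EuclideanSpace.single i (1 : ℝ)) (EuclideanSpace.single j (1 : ℝ)) := by
  ext v k
  simp [sum_apply, Pi.single_apply, PiLp.inner_apply, Finset.mul_sum, mul_comm, mul_assoc]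

theorem sum_tensorProd_single {N : ℕ} (A : Tensor N) :
    ∑ j : Fin N, tensorProd (A (EuclideanSpace.single j 1)) (EuclideanSpace.single j 1) = A := by
  ext v k
  rw [clm_apply_eq_sum A v]
  simp [sum_apply, PiLp.inner_apply]

theorem inner_piola_apply {N : ℕ} (W : Tensor N → ℝ) (F : Tensor N) (a n : Pt N) :
    inner ℝ a (piola W F n) = fderiv ℝ W F (tensorProd a n) := by
  rw [tensorProd_eq_sum a n]
  simp only [piola, map_sum, map_smul, smul_eq_mul, sum_apply, smul_apply, tensorProd_apply,
    inner_sum, inner_smul_right]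
  refine Finset.sum_congr rfl fun i _ => Finset.sum_congr rfl fun j _ => ?_
  simp [PiLp.inner_apply]
  ring

theorem tensorInner_tensorProd {N : ℕ} (S : Tensor N) (a b : Pt N) :
    tensorInner S (tensorProd a b) = inner ℝ a (S b) := by
  rw [tensorInner, LinearMap.trace_eq_sum_inner _ (EuclideanSpace.basisFun (Fin N) ℝ)]
  have h : ∀ i : Fin N, inner ℝ (EuclideanSpace.basisFun (Fin N) ℝ i)
      (((S.adjoint ∘L tensorProd a b : Tensor N) : Pt N →ₗ[ℝ] Pt N)
        (EuclideanSpace.basisFun (Fin N) ℝ i))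
      = b i * inner ℝ (S (EuclideanSpace.single i 1)) a := by
    intro i
    have : (((S.adjoint ∘L tensorProd a b : Tensor N) : Pt N →ₗ[ℝ] Pt N)
        (EuclideanSpace.basisFun (Fin N) ℝ i))
        = S.adjoint (tensorProd a b (EuclideanSpace.single i 1)) := by
      simp
    rw [this, ContinuousLinearMap.adjoint_inner_right, tensorProd_apply, inner_smul_right]
    simp [PiLp.inner_apply]
  rw [Finset.sum_congr rfl fun i _ => h i, clm_apply_eq_sum S b, inner_sum]
  refine Finset.sum_congr rfl fun i _ => ?_
  rw [inner_smul_right, real_inner_comm]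

/-! ### Boundary derivatives of maps that vanish on the boundary. -/

/-- The segment from `x` to `q` first leaves the interior at a frontier point, where `u = 0`; the
mean value inequality applies up to there, and convexity of `B` keeps the segment where the
derivative bound holds. -/
theorem norm_sub_le_of_notMem_interior {N : ℕ} {Ω : Set (Pt N)} (hΩ : IsClosed Ω)
    {u : Pt N → Pt N} (hu : ContinuousOn u Ω) (hd : DifferentiableOn ℝ u (interior Ω))
    {B : Set (Pt N)} (hB : Convex ℝ B) {M : ℝ} (hM0 : 0 ≤ M)
    (hM : ∀ x ∈ B ∩ interior Ω, ‖fderiv ℝ u x‖ ≤ M)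
    (h0 : ∀ x ∈ B ∩ frontier Ω, u x = 0) {x q : Pt N} (hx : x ∈ B ∩ interior Ω)
    (hq : q ∈ B) (hqi : q ∉ interior Ω) : ‖u x‖ ≤ M * ‖q - x‖ := by
  set γ : ℝ → Pt N := fun s => x + s • (q - x) with hγ
  have hγc : Continuous γ := by fun_prop
  set S : Set ℝ := Icc 0 1 ∩ γ ⁻¹' (interior Ω)ᶜ with hS
  have hSc : IsCompact S :=
    isCompact_Icc.inter_right (isOpen_interior.isClosed_compl.preimage hγc)
  have hSne : S.Nonempty := ⟨1, by simp, by simpa [hγ] using hqi⟩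
  obtain ⟨s₀, hs₀, hmin⟩ := hSc.exists_isLeast hSne
  have hlt : ∀ s ∈ Ico 0 s₀, γ s ∈ interior Ω := fun s hs => by
    by_contra hc
    have := hmin ⟨⟨hs.1, hs.2.le.trans hs₀.1.2⟩, hc⟩
    exact absurd hs.2 (not_lt.2 this)
  have hs₀pos : 0 < s₀ := by
    refine lt_of_le_of_ne hs₀.1.1 fun h => hs₀.2 ?_
    rw [← h]
    simpa [hγ] using hx.2
  have hclosΩ : γ s₀ ∈ Ω := by
    have h1 : s₀ ∈ closure (Ico 0 s₀) := by
      rw [closure_Ico hs₀pos.ne]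
      exact ⟨hs₀pos.le, le_rfl⟩
    have h2 : Ico 0 s₀ ⊆ γ ⁻¹' Ω := fun s hs => interior_subset (s := Ω) (hlt s hs)
    exact closure_minimal h2 (hΩ.preimage hγc) h1
  have hγB : ∀ s ∈ Icc (0 : ℝ) 1, γ s ∈ B := fun s hs => by
    exact hB.add_smul_sub_mem hx.1 hq hs
  have hγΩ : ∀ s ∈ Icc 0 s₀, γ s ∈ Ω := fun s hs => by
    rcases hs.2.lt_or_eq with h | h
    · exact interior_subset (hlt s ⟨hs.1, h⟩)
    · rw [h]; exact hclosΩ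
  have hend : u (γ s₀) = 0 := by
    refine h0 _ ⟨hγB _ hs₀.1, ?_⟩
    rw [hΩ.frontier_eq]
    exact ⟨hclosΩ, hs₀.2⟩
  have hderiv : ∀ s ∈ Ico 0 s₀, HasDerivWithinAt (fun s => u (γ s))
      (fderiv ℝ u (γ s) (q - x)) (Ici s) s := fun s hs => by
    have h1 : HasDerivAt γ (q - x) s := by
      have := ((hasDerivAt_id s).smul_const (q - x)).const_add x
      rwa [one_smul] at this
    have h2 := (hd.differentiableAt (isOpen_interior.mem_nhds (hlt s hs))).hasFDerivAt
    exact (h2.comp_hasDerivAt s h1).hasDerivWithinAt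
  have hbound : ∀ s ∈ Ico 0 s₀, ‖fderiv ℝ u (γ s) (q - x)‖ ≤ M * ‖q - x‖ := fun s hs =>
    (ContinuousLinearMap.le_opNorm _ _).trans (mul_le_mul_of_nonneg_right
      (hM _ ⟨hγB s ⟨hs.1, hs.2.le.trans hs₀.1.2⟩, hlt s hs⟩) (norm_nonneg _))
  have key := norm_image_sub_le_of_norm_deriv_right_le_segment
    (hu.comp hγc.continuousOn hγΩ) hderiv hbound s₀ ⟨hs₀pos.le, le_rfl⟩
  have hγ0 : γ 0 = x := by simp [hγ]
  simp only [Function.comp_apply, hend, hγ0, zero_sub, norm_neg, sub_zero] at key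
  refine key.trans (mul_le_of_le_one_right (by positivity) hs₀.1.2)

/-- If a map vanishes on the boundary near a smooth boundary point, then its derivative there
vanishes in the tangential directions. -/
theorem apply_eq_zero_of_tangent {N : ℕ} {Ω : Set (Pt N)} (hΩ : IsClosed Ω)
    {u : Pt N → Pt N} (hu : ContinuousOn u Ω) (hd : DifferentiableOn ℝ u (interior Ω))
    {p n : Pt N} (hn : IsOutwardUnitNormal Ω p n) {A : Tensor N}
    (hA : Tendsto (fderiv ℝ u) (𝓝[interior Ω] p) (𝓝 A))
    (h0 : ∀ᶠ z in 𝓝[frontier Ω] p, u z = 0) {v : Pt N} (hv : inner ℝ n v = 0) : A v = 0 := by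
  obtain ⟨U, g, w, hU, hpU, hg, hgv, hgΩ, hgint, hgf, -, hgp, hne⟩ := hn.exists_chart hΩ
  have hgrad : gradient g p ≠ 0 := fun h => by
    have h1 := hgv p hpU
    rw [fderiv_apply_eq_inner_gradient, h, inner_zero_right] at h1
    exact h1.false
  have hgd : HasFDerivAt g (fderiv ℝ g p) p :=
    ((hg.contDiffAt (hU.mem_nhds hpU)).differentiableAt one_ne_zero).hasFDerivAt
  have hgrad0 : 0 < ‖gradient g p‖ := norm_pos_iff.2 hgrad
  have hnn : ‖n‖ = 1 := by
    rw [hne, norm_smul, norm_inv, norm_norm, inv_mul_cancel₀ hgrad0.ne']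
  have hgn : fderiv ℝ g p n = ‖gradient g p‖ := by
    rw [fderiv_apply_eq_inner_gradient, hne, inner_smul_left, real_inner_self_eq_norm_sq]
    simp
    field_simp
  have hgv0 : fderiv ℝ g p v = 0 := by
    have : gradient g p = ‖gradient g p‖ • n := by
      rw [hne, smul_smul, mul_inv_cancel₀ hgrad0.ne', one_smul]
    rw [fderiv_apply_eq_inner_gradient, this, inner_smul_right, real_inner_comm, hv, mul_zero]
  have hpf : p ∈ frontier Ω := (hgf p hpU).2 hgp
  have hpΩ : p ∈ Ω := hΩ.frontier_subset hpf
  have hup : u p = 0 := h0.self_of_nhdsWithin hpf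
  set M := ‖A‖ + 1 with hM
  have hM0 : 0 < M := by positivity
  obtain ⟨ρ, hρ, hρM⟩ : ∃ ρ > 0, ∀ x ∈ Metric.ball p ρ ∩ interior Ω, ‖fderiv ℝ u x‖ ≤ M := by
    have := (hA.norm.eventually_lt_const (lt_add_one ‖A‖))
    obtain ⟨ρ, hρ, h⟩ := Metric.mem_nhdsWithin_iff.1 this
    exact ⟨ρ, hρ, fun x hx => (h hx).le⟩
  obtain ⟨ρ', hρ', hρ0⟩ := Metric.mem_nhdsWithin_iff.1 h0
  set B := Metric.ball p ρ ∩ Metric.ball p ρ' with hB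
  have hBn : B ∈ 𝓝 p := inter_mem (Metric.ball_mem_nhds p hρ) (Metric.ball_mem_nhds p hρ')
  have hBc : Convex ℝ B := (convex_ball p ρ).inter (convex_ball p ρ')
  have hray : ∀ d : Pt N, Tendsto (fun t : ℝ => p + t • d) (𝓝[>] 0) (𝓝 p) := fun d => by
    have : Tendsto (fun t : ℝ => p + t • d) (𝓝 0) (𝓝 (p + (0 : ℝ) • d)) :=
      Continuous.tendsto (by fun_prop) 0
    simp only [zero_smul, add_zero] at this
    exact this.mono_left nhdsWithin_le_nhds
  have hslope : ∀ d : Pt N, Tendsto (fun t : ℝ => t⁻¹ * g (p + t • d)) (𝓝[>] 0)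
      (𝓝 (fderiv ℝ g p d)) := fun d => by
    have h1 : HasDerivAt (fun t : ℝ => p + t • d) d 0 := by
      simpa using ((hasDerivAt_id (0 : ℝ)).smul_const d).const_add p
    have h2 : HasDerivAt (fun t : ℝ => g (p + t • d)) (fderiv ℝ g p d) 0 :=
      HasFDerivAt.comp_hasDerivAt (0 : ℝ) (by simpa using hgd) h1
    have h3 := h2.tendsto_slope_zero_right
    simpa [hgp] using h3
  -- A tangent ray need not stay on one side of the boundary. Tilting by `∓ η n` gives points inside
  -- and outside at distance `2 η t`, so `u` is at most `2 M η t` at the inner one.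
  have hη : ∀ η > 0, ‖A v‖ ≤ η * (2 * M + ‖A‖) := by
    intro η hη
    have hneg : ∀ᶠ t : ℝ in 𝓝[>] 0, p + t • (v - η • n) ∈ interior Ω := by
      have hlt : fderiv ℝ g p (v - η • n) < 0 := by
        rw [map_sub, map_smul, hgv0, hgn, smul_eq_mul]
        nlinarith
      filter_upwards [(hslope _).eventually_lt_const hlt, hray (v - η • n) (hU.mem_nhds hpU),
        self_mem_nhdsWithin] with t ht htU htpos
      refine (hgint _ htU).2 ?_
      exact neg_of_mul_neg_right ht (inv_pos.2 htpos).le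
    have hpos : ∀ᶠ t : ℝ in 𝓝[>] 0, p + t • (v + η • n) ∉ interior Ω := by
      have hlt : 0 < fderiv ℝ g p (v + η • n) := by
        rw [map_add, map_smul, hgv0, hgn, smul_eq_mul]
        have := mul_pos hη hgrad0
        linarith
      filter_upwards [(hslope _).eventually_const_lt hlt, hray (v + η • n) (hU.mem_nhds hpU),
        self_mem_nhdsWithin] with t ht htU htpos
      rw [hgint _ htU, not_lt]
      exact (pos_of_mul_pos_right ht (inv_pos.2 htpos).le).le
    have hest : ∀ᶠ t : ℝ in 𝓝[>] 0, ‖t⁻¹ • u (p + t • (v - η • n))‖ ≤ M * (2 * η) := by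
      filter_upwards [hneg, hpos, hray (v - η • n) hBn, hray (v + η • n) hBn,
        self_mem_nhdsWithin] with t h1 h2 h3 h4 htpos
      have htpos : 0 < t := htpos
      have h5 := norm_sub_le_of_notMem_interior hΩ hu hd hBc hM0.le
        (fun x hx => hρM x ⟨hx.1.1, hx.2⟩) (fun x hx => hρ0 ⟨hx.1.2, hx.2⟩) ⟨h3, h1⟩ h4 h2
      have h6 : p + t • (v + η • n) - (p + t • (v - η • n)) = (2 * η * t) • n := by
        module
      rw [h6, norm_smul, hnn, mul_one, Real.norm_of_nonneg (by positivity)] at h5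
      rw [norm_smul, Real.norm_of_nonneg (inv_pos.2 htpos).le, inv_mul_le_iff₀ htpos]
      linarith
    have hAd : ‖A (v - η • n)‖ ≤ M * (2 * η) := by
      obtain ⟨τ, hτ, hτi⟩ := mem_nhdsGT_iff_exists_Ioo_subset.1 hneg
      have hτi : ∀ t ∈ Ioo 0 τ, p + t • (v - η • n) ∈ interior Ω := fun t ht => hτi ht
      have hder : ∀ t ∈ Ioo 0 τ, HasDerivAt (fun t : ℝ => u (p + t • (v - η • n)))
          (fderiv ℝ u (p + t • (v - η • n)) (v - η • n)) t := fun t ht => by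
        have h1 : HasDerivAt (fun t : ℝ => p + t • (v - η • n)) (v - η • n) t := by
          simpa using ((hasDerivAt_id t).smul_const (v - η • n)).const_add p
        exact (hd.differentiableAt
          (isOpen_interior.mem_nhds (hτi t ht))).hasFDerivAt.comp_hasDerivAt t h1
      have hmemτ : Ioo (0 : ℝ) τ ∈ 𝓝[>] (0 : ℝ) := Ioo_mem_nhdsGT hτ
      have hcw : ContinuousWithinAt (fun t : ℝ => u (p + t • (v - η • n))) (Ioo 0 τ) 0 := by
        have h1 : ContinuousWithinAt u Ω (p + (0 : ℝ) • (v - η • n)) := by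
          simpa using hu p hpΩ
        exact ContinuousWithinAt.comp (f := fun t : ℝ => p + t • (v - η • n)) h1
          (Continuous.continuousWithinAt (by fun_prop)) fun t ht => interior_subset (s := Ω) (hτi t ht)
      have hlim : Tendsto (fun t => deriv (fun t : ℝ => u (p + t • (v - η • n))) t) (𝓝[>] 0)
          (𝓝 (A (v - η • n))) := by
        have h1 : Tendsto (fun t : ℝ => p + t • (v - η • n)) (𝓝[>] 0) (𝓝[interior Ω] p) :=
          tendsto_nhdsWithin_iff.2 ⟨hray _, hneg⟩
        have h2 := ((ContinuousLinearMap.apply ℝ (Pt N) (v - η • n)).continuous.tendsto A).comp (hA.comp h1)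
        refine h2.congr' ?_
        filter_upwards [hmemτ] with t ht
        exact (hder t ht).deriv.symm
      -- `u` need not be differentiable at `p`; the limit of its derivative along the inner ray is
      -- still the one-sided derivative there.
      have hfin := (hasDerivWithinAt_Ici_of_tendsto_deriv
        (fun t ht => (hder t ht).differentiableAt.differentiableWithinAt) hcw hmemτ hlim)
      have h4 : Tendsto (fun t : ℝ => t⁻¹ • u (p + t • (v - η • n))) (𝓝[>] 0)
          (𝓝 (A (v - η • n))) := by
        have h3 := hasDerivWithinAt_iff_tendsto_slope.1 hfin
        rw [Ici_sdiff_left] at h3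
        refine h3.congr fun t => ?_
        simp [slope, hup]
      exact le_of_tendsto h4.norm hest
    have hsplit : A v = A (v - η • n) + η • A n := by
      rw [map_sub, map_smul]
      abel
    rw [hsplit]
    refine (norm_add_le _ _).trans ?_
    rw [norm_smul, Real.norm_of_nonneg hη.le]
    have := A.le_opNorm n
    rw [hnn, mul_one] at this
    nlinarith [mul_le_mul_of_nonneg_left this hη.le]
  rw [← norm_le_zero_iff]
  have hlim : Tendsto (fun η : ℝ => η * (2 * M + ‖A‖)) (𝓝[>] 0) (𝓝 0) := by
    have : Tendsto (fun η : ℝ => η * (2 * M + ‖A‖)) (𝓝 0) (𝓝 (0 * (2 * M + ‖A‖))) :=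
      tendsto_id.mul_const _
    rw [zero_mul] at this
    exact this.mono_left nhdsWithin_le_nhds
  refine ge_of_tendsto hlim ?_
  filter_upwards [self_mem_nhdsWithin] with η h using hη η h

/-! ### Green's identity. -/

theorem vdiv_sum_smul_single {N : ℕ} {φ : Fin N → Pt N → ℝ} {φ' : Fin N → Pt N →L[ℝ] ℝ} {x : Pt N}
    (h : ∀ j, HasFDerivAt (φ j) (φ' j) x) :
    vdiv (fun z => ∑ j, φ j z • (EuclideanSpace.single j (1 : ℝ) : Pt N)) x
      = ∑ j, φ' j (EuclideanSpace.single j 1) := by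
  have h1 : HasFDerivAt (fun z => ∑ j, φ j z • (EuclideanSpace.single j (1 : ℝ) : Pt N))
      (∑ j, (φ' j).smulRight (EuclideanSpace.single j (1 : ℝ) : Pt N)) x :=
    HasFDerivAt.fun_sum fun j _ => (h j).smul_const _
  rw [vdiv, h1.fderiv]
  refine Finset.sum_congr rfl fun i _ => ?_
  simp [sum_apply, Pi.single_apply]

/-- The field `(W(∇y) - W(1)) x + S(∇y)ᵀ (y - (∇y) x)`, where `G = ∇y`. -/
noncomputable def greenField {N : ℕ} (W : Tensor N → ℝ) (y : Pt N → Pt N) (G : Pt N → Tensor N)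
    (x : Pt N) : Pt N :=
  (W (G x) - W 1) • x +
    ∑ j : Fin N, inner ℝ (y x - G x x) (piola W (G x) (EuclideanSpace.single j 1)) •
      (EuclideanSpace.single j (1 : ℝ) : Pt N)

theorem inner_greenField {N : ℕ} (W : Tensor N → ℝ) (y : Pt N → Pt N) (G : Pt N → Tensor N)
    (x n : Pt N) : inner ℝ (greenField W y G x) n =
      (W (G x) - W 1) * inner ℝ x n + inner ℝ (y x - G x x) (piola W (G x) n) := by
  rw [greenField, inner_add_left, real_inner_smul_left, sum_inner,
    clm_apply_eq_sum (piola W (G x)) n, inner_sum]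
  congr 1
  refine Finset.sum_congr rfl fun j _ => ?_
  rw [real_inner_smul_left, inner_smul_right]
  simp [PiLp.inner_apply, mul_comm]

/-- Green's identity for classical equilibria. -/
theorem vdiv_greenField {N : ℕ} {W : Tensor N → ℝ} {y : Pt N → Pt N} {G : Pt N → Tensor N}
    {x : Pt N} {G' : Pt N →L[ℝ] Tensor N} (hy : HasFDerivAt y (G x) x) (hG : HasFDerivAt G G' x)
    (hsymm : ∀ u v, G' u v = G' v u) (hW : DifferentiableAt ℝ W (G x))
    (hS : DifferentiableAt ℝ (fun z => piola W (G z)) x)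
    (hdiv : tensorDiv (fun z => piola W (G z)) x = 0) :
    vdiv (greenField W y G) x = N * (W (G x) - W 1) := by
  have h1 : HasFDerivAt (fun z => W (G z) - W 1) (fderiv ℝ W (G x) ∘L G') x :=
    (hW.hasFDerivAt.comp x hG).sub_const _
  have hGx : HasFDerivAt (fun z => G z z) (G x + G'.flip x) x := by
    have := hG.clm_apply (hasFDerivAt_id x)
    simpa using this
  have hw : HasFDerivAt (fun z => y z - G z z) (-(G'.flip x)) x := by
    have := hy.fun_sub hGx
    simpa using this
  have hSj : ∀ j : Fin N, HasFDerivAt (fun z => piola W (G z) (EuclideanSpace.single j 1))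
      ((fderiv ℝ (fun z => piola W (G z)) x).flip (EuclideanSpace.single j 1)) x := fun j => by
    have := hS.hasFDerivAt.clm_apply
      (hasFDerivAt_const (EuclideanSpace.single j (1 : ℝ) : Pt N) x)
    simpa using this
  have hφ := fun j => (hw.inner ℝ (hSj j))
  have h2 := vdiv_sum_smul_single hφ
  have hd1 : DifferentiableAt ℝ (fun z => (W (G z) - W 1) • z) x :=
    h1.differentiableAt.smul differentiableAt_id
  have hd2 : DifferentiableAt ℝ (fun z => ∑ j : Fin N,
      inner ℝ (y z - G z z) (piola W (G z) (EuclideanSpace.single j 1)) •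
      (EuclideanSpace.single j (1 : ℝ) : Pt N)) x :=
    DifferentiableAt.fun_sum fun j _ => (hφ j).differentiableAt.smul_const _
  have h3 : vdiv (greenField W y G) x = _ := vdiv_add hd1 hd2
  rw [h3, h2, vdiv_smul h1.differentiableAt differentiableAt_fun_id, vdiv_id, h1.fderiv]
  -- The derivative of `y - G x` is `-G'(·) x`, and symmetry turns `G'(eⱼ) x` into `G'(x) eⱼ`. The
  -- sum over `j` then gives `-DW(G)(G'(x))`, which cancels the derivative of `W(G)` along `x`; the
  -- other part vanishes by equilibrium.
  have hA : ∀ j : Fin N, ((fderivInnerCLM ℝ (y x - G x x,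
        piola W (G x) (EuclideanSpace.single j 1))).comp ((-(G'.flip x)).prod
        ((fderiv ℝ (fun z => piola W (G z)) x).flip (EuclideanSpace.single j 1))))
        (EuclideanSpace.single j 1)
      = inner ℝ (y x - G x x) (fderiv ℝ (fun z => piola W (G z)) x (EuclideanSpace.single j 1)
          (EuclideanSpace.single j 1)) - fderiv ℝ W (G x)
          (tensorProd (G' x (EuclideanSpace.single j 1)) (EuclideanSpace.single j 1)) := by
    intro j
    rw [← inner_piola_apply, hsymm x]
    simp [fderivInnerCLM_apply, sub_eq_add_neg]
  rw [Finset.sum_congr rfl fun j _ => hA j, Finset.sum_sub_distrib, ← inner_sum, ← map_sum,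
    sum_tensorProd_single]
  have hdiv' : ∑ j : Fin N, (fderiv ℝ (fun z => piola W (G z)) x (EuclideanSpace.single j 1)
          (EuclideanSpace.single j 1)) = 0 := hdiv
  rw [hdiv']
  simp [mul_comm]

theorem contDiffOn_piola {N : ℕ} {W : Tensor N → ℝ} (hW : ContDiffOn ℝ 2 W (LinPlus N)) :
    ContDiffOn ℝ 1 (piola W) (LinPlus N) := by
  have h1 : ContDiffOn ℝ 1 (fderiv ℝ W) (LinPlus N) :=
    hW.fderiv_of_isOpen (isOpen_linPlus N) (by norm_num)
  unfold piola
  refine ContDiffOn.sum fun i _ => ContDiffOn.sum fun j _ => ?_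
  exact (h1.clm_apply contDiffOn_const).smul contDiffOn_const

/-! ### Rotations and the minimum of the stored energy. -/

theorem det_one_add_tensorProd {N : ℕ} (a n : Pt N) :
    (1 + tensorProd a n : Tensor N).det = 1 + inner ℝ n a := by
  have h : ((1 + tensorProd a n : Tensor N) : Pt N →ₗ[ℝ] Pt N)
      = LinearMap.transvection ((innerSL ℝ n : Pt N →L[ℝ] ℝ) : Pt N →ₗ[ℝ] ℝ) a := by
    ext v
    simp [LinearMap.transvection.apply]
  rw [ContinuousLinearMap.det, h, LinearMap.transvection.det]
  simp

theorem inner_map_map_of_mem_orthPlus {N : ℕ} {R : Tensor N} (hR : R ∈ OrthPlus N) (u v : Pt N) :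
    inner ℝ (R u) (R v) = inner ℝ u v := by
  rw [← ContinuousLinearMap.adjoint_inner_right]
  have := congrArg (fun T : Tensor N => T v) hR.1
  simp only [ContinuousLinearMap.comp_apply, one_apply_eq_self] at this
  rw [this]

/-- A rotation that is a rank-one perturbation of the identity is the identity. -/
theorem eq_one_of_add_tensorProd_mem_orthPlus {N : ℕ} {a n : Pt N}
    (hR : (1 + tensorProd a n : Tensor N) ∈ OrthPlus N) :
    (1 + tensorProd a n : Tensor N) = 1 := by
  have hdet := hR.2
  rw [det_one_add_tensorProd] at hdet
  have hna : inner ℝ n a = 0 := by linarith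
  by_cases hn : n = 0
  · ext v; simp [hn]
  -- Since `n · a = 0`, the rotation fixes `a` and sends `n` to `n + ‖n‖² a`; preserving their inner
  -- product forces `‖n‖² ‖a‖² = 0`.
  have h1 := inner_map_map_of_mem_orthPlus hR n a
  simp only [add_apply, one_apply_eq_self, tensorProd_apply, hna, zero_smul, add_zero,
    inner_add_left, real_inner_smul_left, zero_add] at h1
  have ha : a = 0 := by
    rcases mul_eq_zero.1 h1 with h | h
    · exact absurd (inner_self_eq_zero.1 h) hn
    · exact inner_self_eq_zero.1 h
  ext v
  simp [ha]

theorem surjective_of_mem_orthPlus {N : ℕ} {R : Tensor N} (hR : R ∈ OrthPlus N) :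
    Function.Surjective R := by
  refine LinearMap.surjective_of_injective (f := (R : Pt N →ₗ[ℝ] Pt N)) ?_
  rw [← LinearMap.ker_eq_bot, LinearMap.ker_eq_bot']
  intro v hv
  have h1 := inner_map_map_of_mem_orthPlus hR v v
  have hv : R v = 0 := hv
  rw [hv, inner_zero_left] at h1
  exact inner_self_eq_zero.1 h1.symm

/-- A `C²` map whose derivatives are rotations has vanishing second derivative. -/
theorem fderiv_fderiv_eq_zero_of_orthPlus {N : ℕ} {O : Set (Pt N)} (hO : IsOpen O)
    {y : Pt N → Pt N} (hy : ContDiffOn ℝ 2 y O) (hR : ∀ x ∈ O, fderiv ℝ y x ∈ OrthPlus N)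
    {x : Pt N} (hx : x ∈ O) : fderiv ℝ (fderiv ℝ y) x = 0 := by
  have hyx := hy.contDiffAt (hO.mem_nhds hx)
  have hsymm : ∀ u v, fderiv ℝ (fderiv ℝ y) x u v = fderiv ℝ (fderiv ℝ y) x v u :=
    fun u v => (hyx.isSymmSndFDerivAt (by simp)) u v
  have hd : HasFDerivAt (fderiv ℝ y) (fderiv ℝ (fderiv ℝ y) x) x :=
    ((hyx.fderiv_right (m := 1) (by norm_num)).differentiableAt one_ne_zero).hasFDerivAt
  have hskew : ∀ w u v, inner ℝ (fderiv ℝ (fderiv ℝ y) x w u) (fderiv ℝ y x v)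
      = - inner ℝ (fderiv ℝ (fderiv ℝ y) x w v) (fderiv ℝ y x u) := by
    intro w u v
    have h1 := ((hd.clm_apply (hasFDerivAt_const u x)).inner ℝ
      (hd.clm_apply (hasFDerivAt_const v x)))
    have h2 : HasFDerivAt (fun z => inner ℝ (fderiv ℝ y z u) (fderiv ℝ y z v))
        (0 : Pt N →L[ℝ] ℝ) x := by
      refine (hasFDerivAt_const (inner ℝ u v) x).congr_of_eventuallyEq ?_
      filter_upwards [hO.mem_nhds hx] with z hz using inner_map_map_of_mem_orthPlus (hR z hz) u v
    have h3 := congrArg (fun T : Pt N →L[ℝ] ℝ => T w) (h1.unique h2)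
    simp [fderivInnerCLM_apply] at h3
    rw [real_inner_comm (fderiv ℝ y x u)]
    linarith
  -- The trilinear form `D²y(w, u) · Dy v` is symmetric in its first two arguments and skew in the
  -- last two; going round the cyclic permutations shows that it vanishes.
  have hzero : ∀ w u v, inner ℝ (fderiv ℝ (fderiv ℝ y) x w u) (fderiv ℝ y x v) = 0 := by
    intro w u v
    have h1 := hskew w u v
    have h2 := hskew v w u
    have h3 := hskew u v w
    rw [hsymm w v] at h1
    rw [hsymm v u] at h2
    rw [hsymm u w] at h3
    linarith
  ext1 w
  ext1 u
  obtain ⟨v, hv⟩ := surjective_of_mem_orthPlus (hR x hx) (fderiv ℝ (fderiv ℝ y) x w u)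
  have := hzero w u v
  rw [hv] at this
  exact inner_self_eq_zero.1 this

theorem IsMixedRegion.one_le {N : ℕ} {Ω D L : Set (Pt N)} (h : IsMixedRegion Ω D L) : 1 ≤ N := by
  by_contra hN
  obtain rfl : N = 0 := by omega
  obtain ⟨x, hx⟩ := h.interior_nonempty
  obtain ⟨d, hd⟩ := h.nonempty
  have hf : d ∈ frontier Ω := h.union_eq ▸ Or.inl hd
  rw [Subsingleton.elim x d] at hx
  exact hf.2 hx

theorem one_mem_orthPlus (N : ℕ) : (1 : Tensor N) ∈ OrthPlus N := by
  refine ⟨?_, ?_⟩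
  · ext1 v
    refine ext_inner_right ℝ fun w => ?_
    simp [ContinuousLinearMap.adjoint_inner_left]
  · rw [ContinuousLinearMap.det]
    exact LinearMap.det_id

/-- The equality `W R = W 1` is available only alongside a competitor outside the rotations, so one
has to exist; this needs `N ≥ 1`. -/
theorem exists_mem_linPlus_diff_orthPlus {N : ℕ} (hN : 1 ≤ N) :
    ∃ F, F ∈ LinPlus N \ OrthPlus N := by
  refine ⟨(2 : ℝ) • (1 : Tensor N), ?_, fun h => ?_⟩
  · have : ((2 : ℝ) • (1 : Tensor N)).det = 2 ^ N := by
      have h1 : (((2 : ℝ) • (1 : Tensor N) : Tensor N) : Pt N →ₗ[ℝ] Pt N)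
          = (2 : ℝ) • LinearMap.id := rfl
      rw [ContinuousLinearMap.det, h1, LinearMap.det_smul]
      simp
    rw [LinPlus, mem_ofPred_eq, this]
    positivity
  · have h1 := inner_map_map_of_mem_orthPlus h (EuclideanSpace.single ⟨0, hN⟩ 1)
      (EuclideanSpace.single ⟨0, hN⟩ 1)
    simp only [smul_apply, one_apply_eq_self, real_inner_smul_left, inner_smul_right,
      EuclideanSpace.inner_single_left] at h1
    norm_num at h1

theorem le_energy {N : ℕ} (hN : 1 ≤ N) {W : Tensor N → ℝ}
    (hmin : ∀ F ∈ LinPlus N \ OrthPlus N, ∀ R ∈ OrthPlus N, W F > W R ∧ W R = W 1)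
    {F : Tensor N} (hF : F ∈ LinPlus N) : W 1 ≤ W F := by
  by_cases h : F ∈ OrthPlus N
  · obtain ⟨F₁, hF₁⟩ := exists_mem_linPlus_diff_orthPlus hN
    exact (hmin F₁ hF₁ F h).2.ge
  · exact (hmin F ⟨hF, h⟩ 1 (one_mem_orthPlus N)).1.le

/-- The natural state is stress free. -/
theorem piola_one_eq_zero {N : ℕ} {W : Tensor N → ℝ} (h : ∀ F ∈ LinPlus N, W 1 ≤ W F) :
    piola W 1 = 0 := by
  have : IsLocalMin W 1 := by
    filter_upwards [(isOpen_linPlus N).mem_nhds (one_mem_linPlus N)] with F hF using h F hF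
  refine Finset.sum_eq_zero fun i _ => Finset.sum_eq_zero fun j _ => ?_
  rw [this.fderiv_eq_zero, zero_apply]
  exact zero_smul ℝ (tensorProd (EuclideanSpace.single i 1) (EuclideanSpace.single j 1) : Tensor N)

/-! ### The identity as a solution. -/

theorem grad_id {N : ℕ} {Ω : Set (Pt N)} {x : Pt N} (hx : x ∈ closure (interior Ω)) :
    grad Ω (fun x => x) x = 1 := by
  refine extendFrom_eq hx ?_
  have : fderiv ℝ (fun x : Pt N => x) = fun _ => 1 := by
    ext1 z
    exact fderiv_fun_id
  rw [this]
  exact tendsto_const_nhds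

theorem isProblemASolution_id {N : ℕ} {Ω D L : Set (Pt N)} {W : Tensor N → ℝ}
    (hΩ : IsMixedRegion Ω D L) : IsProblemASolution Ω D L W 1 (fun x => x) := by
  have hg : ∀ x ∈ Ω, grad Ω (fun x => x) x = 1 := fun x hx =>
    grad_id (hΩ.subset_closure_interior hx)
  refine ⟨⟨contDiffOn_id, continuousOn_id, continuousOn_const.congr hg, fun x hx => ?_,
    fun x hx => ?_⟩, fun x _ => by simp, fun x hx n _ => ?_⟩
  · rw [hg x hx]
    exact one_mem_linPlus N
  · have : (fun z => piola W (grad Ω (fun x => x) z)) =ᶠ[𝓝 x] fun _ => piola W 1 := by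
      filter_upwards [isOpen_interior.mem_nhds hx] with z hz
      rw [hg z (interior_subset hz)]
    simp [tensorDiv, this.fderiv_eq]
  · have hxf : x ∈ frontier Ω := hΩ.union_eq ▸ Or.inr hx
    rw [hg x (hΩ.isCompact.isClosed.frontier_subset hxf)]

/-! ### Regularity and boundary gradients of classical equilibria. -/

section Equilibrium

variable {N : ℕ} {Ω : Set (Pt N)} {W : Tensor N → ℝ} {y : Pt N → Pt N}

theorem IsClassicalEquilibrium.grad_eq (h : IsClassicalEquilibrium Ω W y) {x : Pt N}
    (hx : x ∈ interior Ω) : grad Ω y x = fderiv ℝ y x :=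
  grad_eq_fderiv (h.contDiffOn_interior.of_le (by norm_num)) hx

theorem IsClassicalEquilibrium.hasFDerivAt (h : IsClassicalEquilibrium Ω W y) {x : Pt N}
    (hx : x ∈ interior Ω) : HasFDerivAt y (grad Ω y x) x := by
  rw [h.grad_eq hx]
  exact ((h.contDiffOn_interior.contDiffAt (isOpen_interior.mem_nhds hx)).differentiableAt
    two_ne_zero).hasFDerivAt

theorem IsClassicalEquilibrium.contDiffOn_grad (h : IsClassicalEquilibrium Ω W y) :
    ContDiffOn ℝ 1 (grad Ω y) (interior Ω) :=
  (h.contDiffOn_interior.fderiv_of_isOpen isOpen_interior (by norm_num)).congr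
    fun _ hx => h.grad_eq hx

theorem IsClassicalEquilibrium.fderiv_grad (h : IsClassicalEquilibrium Ω W y) {x : Pt N}
    (hx : x ∈ interior Ω) : fderiv ℝ (grad Ω y) x = fderiv ℝ (fderiv ℝ y) x := by
  refine Filter.EventuallyEq.fderiv_eq ?_
  filter_upwards [isOpen_interior.mem_nhds hx] with z hz using h.grad_eq hz

/-- Second derivatives of `y` may blow up at the boundary, but by Green's identity the divergence
involves only `∇y`, which is continuous on `Ω`. -/
theorem IsClassicalEquilibrium.isRegularField_greenField (h : IsClassicalEquilibrium Ω W y)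
    (hW : ContDiffOn ℝ 2 W (LinPlus N)) :
    IsRegularField Ω (greenField W y (grad Ω y)) (fun x => N * (W (grad Ω y x) - W 1)) := by
  have hS := contDiffOn_piola hW
  have hmaps : MapsTo (grad Ω y) Ω (LinPlus N) := h.grad_mem
  have hmaps' : MapsTo (grad Ω y) (interior Ω) (LinPlus N) := hmaps.mono_left interior_subset
  have hGd := h.contDiffOn_grad
  refine ⟨?_, ?_, ?_, fun x hx => ?_⟩
  · refine (((hW.continuousOn.comp h.continuousOn_grad hmaps).sub continuousOn_const).smul
      continuousOn_id).add (continuousOn_finsetSum _ fun j _ => ContinuousOn.fun_smul ?_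
        continuousOn_const)
    exact (h.continuousOn.sub (h.continuousOn_grad.clm_apply continuousOn_id)).inner
      ((hS.continuousOn.comp h.continuousOn_grad hmaps).clm_apply continuousOn_const)
  · have hy1 : ContDiffOn ℝ 1 y (interior Ω) := h.contDiffOn_interior.of_le (by norm_num)
    have hW1 : ContDiffOn ℝ 1 W (LinPlus N) := hW.of_le (by norm_num)
    refine (((hW1.comp hGd hmaps').sub contDiffOn_const).smul contDiffOn_id).add
      (ContDiffOn.sum fun j _ => ContDiffOn.fun_smul ?_ contDiffOn_const)
    exact (hy1.sub (hGd.clm_apply contDiffOn_id)).inner ℝ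
      ((hS.comp hGd hmaps').clm_apply contDiffOn_const)
  · exact continuousOn_const.mul
      ((hW.continuousOn.comp h.continuousOn_grad hmaps).sub continuousOn_const)
  · have hxn := isOpen_interior.mem_nhds hx
    have hGx : DifferentiableAt ℝ (grad Ω y) x :=
      (hGd.contDiffAt hxn).differentiableAt one_ne_zero
    have hLn := (isOpen_linPlus N).mem_nhds (hmaps' hx)
    refine vdiv_greenField (h.hasFDerivAt hx) hGx.hasFDerivAt (fun u v => ?_)
      ((hW.contDiffAt hLn).differentiableAt two_ne_zero)
      (((hS.contDiffAt hLn).differentiableAt one_ne_zero).comp x hGx) (h.div_eq_zero x hx)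
    rw [h.fderiv_grad hx]
    exact ((h.contDiffOn_interior.contDiffAt hxn).isSymmSndFDerivAt (by simp)) u v

/-- At a smooth boundary point near which `y` is the identity on the boundary, `∇y` is a rank-one
perturbation of the identity. -/
theorem IsClassicalEquilibrium.exists_grad_eq_add_tensorProd (h : IsClassicalEquilibrium Ω W y)
    (hΩ : IsClosed Ω) {p n : Pt N} (hn : IsOutwardUnitNormal Ω p n) (hp : p ∈ Ω)
    (hD : ∀ᶠ z in 𝓝[frontier Ω] p, y z = z) : ∃ a, grad Ω y p = 1 + tensorProd a n := by
  have hdiff : DifferentiableOn ℝ (fun z => y z - z) (interior Ω) := fun z hz =>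
    ((h.hasFDerivAt hz).differentiableAt.sub differentiableAt_fun_id).differentiableWithinAt
  have hlim : Tendsto (fderiv ℝ (fun z => y z - z)) (𝓝[interior Ω] p) (𝓝 (grad Ω y p - 1)) := by
    have h1 : Tendsto (fun z => grad Ω y z - 1) (𝓝[interior Ω] p) (𝓝 (grad Ω y p - 1)) :=
      ((h.continuousOn_grad p hp).mono_left (nhdsWithin_mono _ interior_subset)).sub_const 1
    refine h1.congr' ?_
    filter_upwards [self_mem_nhdsWithin] with z hz
    exact ((h.hasFDerivAt hz).sub (hasFDerivAt_id z)).fderiv.symm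
  have htan : ∀ v, inner ℝ n v = 0 → (grad Ω y p - 1) v = 0 := fun v hv =>
    apply_eq_zero_of_tangent hΩ (h.continuousOn.sub continuousOn_id) hdiff hn hlim
      (hD.mono fun z hz => sub_eq_zero.2 hz) hv
  have hnn : inner ℝ n n = (1 : ℝ) := by
    obtain ⟨_, g, _, _, _, _, _, hg, rfl⟩ := hn
    have := norm_pos_iff.2 hg
    rw [real_inner_self_eq_norm_sq, norm_smul, norm_inv, norm_norm, inv_mul_cancel₀ this.ne',
      one_pow]
  refine ⟨(grad Ω y p - 1) n, ?_⟩
  rw [← sub_eq_iff_eq_add']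
  ext1 v
  have h1 := htan (v - inner ℝ n v • n) (by
    rw [inner_sub_right, inner_smul_right, hnn, mul_one, sub_self])
  rw [map_sub, map_smul, sub_eq_zero] at h1
  rw [h1, tensorProd_apply]

end Equilibrium

/-! ### Propagation from `D` and the boundary sign of the Green field. -/

/-- A nonnegative locally constant function on `Ω` that vanishes at the smooth points of `D` is
zero. -/
theorem eq_zero_of_fderiv_eq_zero {N : ℕ} {Ω D L Z : Set (Pt N)} (hN : 1 ≤ N) (hΩ : IsCompact Ω)
    (hDL : D ∪ L = frontier Ω) (hpart : PartitionCondition Ω D L)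
    (hsm : ∀ x ∈ frontier Ω \ Z, ∃ n, IsOutwardUnitNormal Ω x n) (hZ : IsClosed Z)
    (hZf : Z ⊆ frontier Ω) (hZ0 : Measure.hausdorffMeasure ((N : ℝ) - 1) Z = 0)
    {φ : Pt N → ℝ} (hφc : ContinuousOn φ Ω) (hφd : ContDiffOn ℝ 1 φ (interior Ω))
    (hφ' : ∀ x ∈ interior Ω, fderiv ℝ φ x = 0) (hφ0 : ∀ x, 0 ≤ φ x)
    (hφD : ∀ x ∈ D \ Z, φ x = 0) : ∀ x ∈ interior Ω, φ x = 0 := by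
  -- As `φ` is locally constant, `φ(x) x` has divergence `N φ ≥ 0`. It vanishes at the smooth points
  -- of `D` and does not point outwards on `L`, so no connectedness is needed.
  have hreg : IsRegularField Ω (fun x => φ x • x) (fun x => φ x * N) := by
    refine ⟨hφc.smul continuousOn_id, hφd.smul contDiffOn_id, hφc.mul continuousOn_const,
      fun x hx => ?_⟩
    rw [vdiv_smul ((hφd.contDiffAt (isOpen_interior.mem_nhds hx)).differentiableAt one_ne_zero)
      differentiableAt_fun_id, vdiv_id, hφ' x hx]
    simp
  intro x hx
  have h := hreg.eq_zero hN hΩ hsm hZ hZf hZ0 (fun x hx n hn => ?_)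
    (fun x _ => mul_nonneg (hφ0 x) N.cast_nonneg) x hx
  · have : (N : ℝ) ≠ 0 := by exact_mod_cast (by omega : N ≠ 0)
    exact (mul_eq_zero.1 h).resolve_right this
  · rw [real_inner_smul_left]
    rw [← hDL] at hx
    rcases hx.1 with hD | hL
    · rw [hφD x ⟨hD, hx.2⟩, zero_mul]
    · exact mul_nonpos_of_nonneg_of_nonpos (hφ0 x) (hpart.2 x hL n hn)

/-- The displacement and traction data make the field `greenField` point inwards. -/
theorem IsProblemASolution.inner_greenField_nonpos {N : ℕ} {Ω D L : Set (Pt N)} {W : Tensor N → ℝ}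
    {y : Pt N → Pt N} (h : IsProblemASolution Ω D L W 1 y) (hΩ : IsCompact Ω)
    (hDL : D ∪ L = frontier Ω) (hpart : PartitionCondition Ω D L) (hrank : RankOneConvex W)
    (hmin : ∀ F ∈ LinPlus N, W 1 ≤ W F) {x : Pt N} (hx : x ∈ frontier Ω)
    (hxD : x ∈ D → ∀ᶠ z in 𝓝[frontier Ω] x, z ∈ D) {n : Pt N} (hn : IsOutwardUnitNormal Ω x n) :
    inner ℝ (greenField W y (grad Ω y) x) n ≤ 0 := by
  have hxΩ : x ∈ Ω := hΩ.isClosed.frontier_subset hx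
  have hGx := h.equilibrium.grad_mem x hxΩ
  rw [inner_greenField]
  rw [← hDL] at hx
  rcases hx with hD | hL
  · obtain ⟨a, ha⟩ := h.equilibrium.exists_grad_eq_add_tensorProd hΩ.isClosed hn hxΩ
      ((hxD hD).mono fun z hz => by simpa using h.displacement z hz)
    have hyx : y x = x := by simpa using h.displacement x hD
    have hw : y x - grad Ω y x x = -(inner ℝ n x • a) := by
      rw [hyx, ha]
      simp
    have hneg : (1 : Tensor N) - grad Ω y x = tensorProd (-a) n := by
      rw [ha]
      ext1 v
      simp
    -- Rank-one convexity is taken from `∇y` towards `1`, which gives `W(∇y) - W(1) ≤ S(∇y) · (a ⊗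
    -- n)`; this is then multiplied by `x · n ≥ 0`.
    have hr := hrank 1 (one_mem_linPlus N) (grad Ω y x) hGx ⟨-a, n, hneg⟩
    rw [hneg, tensorInner_tensorProd, inner_neg_left] at hr
    rw [hw, inner_neg_left, real_inner_smul_left, real_inner_comm x n]
    have hxn := hpart.1 x hD n hn
    nlinarith
  · rw [h.traction x hL n hn, piola_one_eq_zero hmin, zero_apply, inner_zero_right, add_zero]
    exact mul_nonpos_of_nonneg_of_nonpos (sub_nonneg.2 (hmin _ hGx)) (hpart.2 x hL n hn)

end Elastostatics

/-! ### Assembly of the uniqueness proof. -/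

open Elastostatics
theorem proposition2 (N : ℕ) (Ω D L : Set (Pt N)) (W : Tensor N → ℝ)
    (hΩ : IsMixedRegion Ω D L)
    (hW : ContDiffOn ℝ 2 W (LinPlus N))
    (hpart : PartitionCondition Ω D L)
    (hrank : RankOneConvex W)
    (hmin : ∀ F ∈ LinPlus N \ OrthPlus N, ∀ R ∈ OrthPlus N, W F > W R ∧ W R = W 1) :
    IsProblemASolution Ω D L W 1 (fun x => x) ∧
      ∀ y : Pt N → Pt N, IsProblemASolution Ω D L W 1 y → ∀ x ∈ Ω, y x = x := by
  refine ⟨isProblemASolution_id hΩ, fun y hy => ?_⟩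
  have hN := hΩ.one_le
  have hc := hΩ.isCompact
  obtain ⟨Z, hZ, hZf, hZ0, hZs⟩ := hΩ.piecewise_smooth
  have hsm : ∀ x ∈ frontier Ω \ Z, ∃ n, IsOutwardUnitNormal Ω x n := fun x hx => (hZs x hx).1
  have hDev : ∀ x ∈ frontier Ω \ Z, x ∈ D → ∀ᶠ z in 𝓝[frontier Ω] x, z ∈ D := by
    intro x hx hxD
    refine (hZs x hx).2.resolve_right fun hL => ?_
    exact hΩ.disjoint.le_bot ⟨hxD, hL.self_of_nhdsWithin hx.1⟩
  have heq := hy.equilibrium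
  have hle : ∀ F ∈ LinPlus N, W 1 ≤ W F := fun F hF => le_energy hN hmin hF
  have henergy : ∀ x ∈ interior Ω, W (grad Ω y x) = W 1 := by
    intro x hx
    have h := (heq.isRegularField_greenField hW).eq_zero hN hc hsm hZ hZf hZ0
      (fun x hx n hn => hy.inner_greenField_nonpos hc hΩ.union_eq hpart hrank hle hx.1
        (hDev x hx) hn)
      (fun x hx => mul_nonneg N.cast_nonneg
        (sub_nonneg.2 (hle _ (heq.grad_mem x (interior_subset hx))))) x hx
    have hN0 : (N : ℝ) ≠ 0 := by exact_mod_cast (by omega : N ≠ 0)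
    exact sub_eq_zero.1 ((mul_eq_zero.1 h).resolve_left hN0)
  have henergyΩ : ∀ x ∈ Ω, W (grad Ω y x) = W 1 :=
    EqOn.of_subset_closure (f := fun x => W (grad Ω y x)) (g := fun _ => W 1) henergy
      (hW.continuousOn.comp heq.continuousOn_grad heq.grad_mem) continuousOn_const
      interior_subset hΩ.subset_closure_interior
  have horth : ∀ x ∈ Ω, grad Ω y x ∈ OrthPlus N := by
    intro x hx
    by_contra hcon
    have := (hmin _ ⟨heq.grad_mem x hx, hcon⟩ 1 (one_mem_orthPlus N)).1
    rw [henergyΩ x hx] at this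
    exact lt_irrefl _ this
  have hgradD : ∀ x ∈ D \ Z, grad Ω y x = 1 := by
    intro x hx
    have hxf : x ∈ frontier Ω := hΩ.union_eq ▸ Or.inl hx.1
    have hxΩ := hc.isClosed.frontier_subset hxf
    obtain ⟨n, hn⟩ := hsm x ⟨hxf, hx.2⟩
    obtain ⟨a, ha⟩ := heq.exists_grad_eq_add_tensorProd hc.isClosed hn hxΩ
      ((hDev x ⟨hxf, hx.2⟩ hx.1).mono fun z hz => by simpa using hy.displacement z hz)
    have h1 := horth x hxΩ
    rw [ha] at h1 ⊢
    exact eq_one_of_add_tensorProd_mem_orthPlus h1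
  have hG' : ∀ x ∈ interior Ω, fderiv ℝ (grad Ω y) x = 0 := fun x hx => by
    rw [heq.fderiv_grad hx]
    refine fderiv_fderiv_eq_zero_of_orthPlus isOpen_interior heq.contDiffOn_interior
      (fun z hz => ?_) hx
    rw [← heq.grad_eq hz]
    exact horth z (interior_subset hz)
  -- A smooth nonnegative scalar that vanishes only at `F = 1`, so that propagation from `D` applies
  -- to `∇y`.
  set q : Tensor N → ℝ := fun F => ∑ j : Fin N,
    ‖F (EuclideanSpace.single j 1) - EuclideanSpace.single j 1‖ ^ 2 with hq
  have hqd : ContDiff ℝ 1 q := by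
    refine ContDiff.sum fun j _ => ContDiff.norm_sq ℝ ?_
    exact (contDiff_id.clm_apply contDiff_const).sub contDiff_const
  have hqgrad := eq_zero_of_fderiv_eq_zero hN hc hΩ.union_eq hpart hsm hZ hZf hZ0
    (φ := fun x => q (grad Ω y x)) (hqd.continuous.comp_continuousOn heq.continuousOn_grad)
    (hqd.comp_contDiffOn heq.contDiffOn_grad)
    (fun x hx => by
      have hd := ((heq.contDiffOn_grad.contDiffAt
        (isOpen_interior.mem_nhds hx)).differentiableAt one_ne_zero).hasFDerivAt
      rw [hG' x hx] at hd
      have := ((hqd.differentiable one_ne_zero (grad Ω y x)).hasFDerivAt.comp x hd).fderiv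
      rw [ContinuousLinearMap.comp_zero] at this
      exact this)
    (fun x => Finset.sum_nonneg fun j _ => sq_nonneg _)
    (fun x hx => by simp [hq, hgradD x hx])
  have hgrad : ∀ x ∈ interior Ω, grad Ω y x = 1 := by
    intro x hx
    have h := (Finset.sum_eq_zero_iff_of_nonneg fun j _ => sq_nonneg _).1 (hqgrad x hx)
    ext1 v
    rw [clm_apply_eq_sum (grad Ω y x) v, clm_apply_eq_sum (1 : Tensor N) v]
    refine Finset.sum_congr rfl fun j hj => ?_
    have := sub_eq_zero.1 (norm_eq_zero.1 (pow_eq_zero_iff two_ne_zero |>.1 (h j hj)))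
    rw [this]
    rfl
  have hu : ∀ x ∈ interior Ω, HasFDerivAt (fun z => y z - z) (0 : Tensor N) x := fun x hx => by
    have h1 := heq.hasFDerivAt hx
    rw [hgrad x hx] at h1
    have h2 := h1.fun_sub (hasFDerivAt_id x)
    rwa [show (1 : Tensor N) - ContinuousLinearMap.id ℝ (Pt N) = 0 from sub_self _] at h2
  have hy1 : ContDiffOn ℝ 1 y (interior Ω) := heq.contDiffOn_interior.of_le (by norm_num)
  -- With `∇y = 1`, the map `y` is a translation on each component of the interior; the second
  -- propagation from `D` excludes nonzero translations.
  have hdisp := eq_zero_of_fderiv_eq_zero hN hc hΩ.union_eq hpart hsm hZ hZf hZ0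
    (φ := fun x => ‖y x - x‖ ^ 2) ((heq.continuousOn.sub continuousOn_id).norm.pow 2)
    ((hy1.sub contDiffOn_id).norm_sq ℝ)
    (fun x hx => by
      rw [((hu x hx).norm_sq).fderiv]
      simp)
    (fun x => sq_nonneg _)
    (fun x hx => by
      have : y x = x := by simpa using hy.displacement x hx.1
      simp [this])
  exact EqOn.of_subset_closure (f := y) (g := fun x => x) (fun x hx => by
      simpa [sub_eq_zero] using hdisp x hx) heq.continuousOn continuousOn_id
    interior_subset hΩ.subset_closure_interior
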